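/- Let $N$ be a compact (Hausdorff, smooth, without boundary) manifold with a hyperkähler structure $(I,J,K,g)$: $I,J,K$ are (integrable) complex structures with $I^2=J^2=K^2=-1$ and $IJ=-JI=K$, $g$ is a Riemannian metric with respect to which $I,J,K$ are skew, and the fundamental forms $\omega_I,\omega_J,\omega_K$, where $\omega_A(X,Y)=g(AX,Y)$, are closed. Let $\psi$ be a hyperkähler isometry, i.e. a diffeomorphism of $N$ that preserves $g$ and whose differential commutes with $I$, $J$ and $K$. Let $N_\psi=(N\times\mathbb R)/\mathbb Z$ be the mapping torus of $\psi$, where $n\in\mathbb Z$ acts by $n\cdot(p,t)=(\psi^n(p),t+n)$. Then the product $N_\psi\times S^3$ admits a strong HKT structure, that is, there are on $N_\psi\times S^3$ three complex structures $I',J',K'$ with $I'J'=-J'I'=K'$ and a Riemannian metric $g'$, with respect to which $I',J',K'$ are skew, such that 1. (HKT) the Bismut connections of the Hermitian structures $(g',I')$, $(g',J')$, $(g',K')$ coincide, where the Bismut connection of $(g',A)$ is given by $g'(\nabla^B_XY,Z)=g'(\nabla^{LC}_XY,Z)+\tfrac12\,d\omega_A(AX,AY,AZ)$, with $\nabla^{LC}$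 the Levi-Civita connection of $g'$; 2. (strong) their common torsion $3$-form $H(X,Y,Z)=d\omega_A(AX,AY,AZ)$, $A\in\{I',J',K'\}$, is closed: $dH=0$. -/

import Mathlib

open scoped Manifold ContDiff Bundle Topology

noncomputable section

/-! ### Tensor fields, differential forms and the exterior derivative on a manifold -/

section Forms

variable {E : Type*} [NormedAddCommGroup E] [NormedSpace ℝ E]
  {H : Type*} [TopologicalSpace H] (IM : ModelWithCorners ℝ E H)
  (M : Type*) [TopologicalSpace M] [ChartedSpace H M]

/-- Differential `k`-forms (no smoothness built in). -/
abbrev FormField (k : ℕ) : Type _ :=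
  (x : M) → (TangentSpace IM x) [⋀^Fin k]→L[ℝ] ℝ

/-- Fields of endomorphisms of the tangent spaces (no smoothness built in). -/
abbrev EndField : Type _ :=
  (x : M) → TangentSpace IM x →L[ℝ] TangentSpace IM x

/-- Vector fields (no smoothness built in). -/
abbrev TangentField : Type _ :=
  (x : M) → TangentSpace IM x

variable {IM M}

/-- The coordinate expression, on the target of the extended chart at `x`, of a differential form:
its pullback under the inverse of the chart. -/
def FormField.inChart {k : ℕ} (α : FormField IM M k) (x : M) : E → E [⋀^Fin k]→L[ℝ] ℝ :=
  fun y => (α ((extChartAt IM x).symm y)).compContinuousLinearMap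
    (mfderiv 𝓘(ℝ, E) IM (extChartAt IM x).symm y :
      E →L[ℝ] TangentSpace IM ((extChartAt IM x).symm y))

/-- The exterior derivative of a differential form on a manifold without boundary: at `x`, it is
the pullback under the chart at `x` of the exterior derivative of the coordinate expression. -/
def FormField.extDer {k : ℕ} (α : FormField IM M k) : FormField IM M (k + 1) :=
  fun x => (_root_.extDeriv (α.inChart x) (extChartAt IM x x)).compContinuousLinearMap
    (mvfderiv IM (extChartAt IM x) x)

/-- For an endomorphism field `A` and a form `α`, the form
`(A α)(X, Y, …) = α (A X, A Y, …)`. -/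
def EndField.act {k : ℕ} (A : EndField IM M) (α : FormField IM M k) : FormField IM M k :=
  fun x => (α x).compContinuousLinearMap (A x)

variable [IsManifold IM ∞ M]

/-- Smoothness of an endomorphism field. -/
def EndField.IsSmooth (A : EndField IM M) : Prop :=
  ContMDiff IM (IM.prod 𝓘(ℝ, E →L[ℝ] E)) ∞
    (fun x => (⟨x, A x⟩ : Bundle.TotalSpace (E →L[ℝ] E)
      (fun x : M => TangentSpace IM x →L[ℝ] TangentSpace IM x)))

/-- Smoothness of a vector field. -/
def TangentField.IsSmooth (X : TangentField IM M) : Prop :=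
  ContMDiff IM IM.tangent ∞ (fun x => (⟨x, X x⟩ : TangentBundle IM M))

/-- A complex structure, given by its endomorphism field `A`: `A` is smooth, `A² = -1`, and `M` is
covered by the domains of smooth charts with values in some `ℂᵏ` whose differentials carry `A` to
multiplication by `i` (holomorphic charts). -/
structure IsComplexStructure (A : EndField IM M) : Prop where
  smooth : A.IsSmooth
  sq : ∀ (x : M) (v : TangentSpace IM x), A x (A x v) = -v
  integrable : ∀ x : M, ∃ (k : ℕ) (φ : OpenPartialHomeomorph M (Fin k → ℂ)), x ∈ φ.source ∧
    ContMDiffOn IM 𝓘(ℝ, Fin k → ℂ) ∞ φ φ.source ∧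
    ContMDiffOn 𝓘(ℝ, Fin k → ℂ) IM ∞ φ.symm φ.target ∧
    ∀ y ∈ φ.source, ∀ v : TangentSpace IM y,
      mvfderiv IM φ y (A y v) = Complex.I • mvfderiv IM φ y v

end Forms

/-! ### Hyperhermitian, hyperkähler, HKT and strong HKT structures -/

section Hyperhermitian

variable {E : Type*} [NormedAddCommGroup E] [NormedSpace ℝ E]
  {H : Type*} [TopologicalSpace H] (IM : ModelWithCorners ℝ E H)
  (M : Type*) [TopologicalSpace M] [ChartedSpace H M] [IsManifold IM ∞ M]

/-- A smooth Riemannian metric on `M`. -/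
abbrev SmoothMetric : Type _ :=
  Bundle.ContMDiffRiemannianMetric IM ∞ E (fun x : M => TangentSpace IM x)

variable {IM M}

/-- The metric `g` is Hermitian for `A`, i.e. `A` is skew with respect to `g`. -/
def SmoothMetric.IsSkew (g : SmoothMetric IM M) (A : EndField IM M) : Prop :=
  ∀ (x : M) (v w : TangentSpace IM x), g.inner x (A x v) w = -g.inner x v (A x w)

/-- The fundamental `2`-form `ω_A (X, Y) = g (A X, Y)` of a skew endomorphism field `A`. -/
def fundamentalForm (g : SmoothMetric IM M) (A : EndField IM M) (h : g.IsSkew A) :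
    FormField IM M 2 := fun x =>
  { toFun := fun v => g.inner x (A x (v 0)) (v 1)
    map_update_add' := by
      intro _ m i a b
      fin_cases i <;> simp [Function.update]
    map_update_smul' := by
      intro _ m i c a
      fin_cases i <;> simp [Function.update]
    cont := by
      let B : E →L[ℝ] E →L[ℝ] ℝ := (g.inner x).comp (A x)
      have h0 : Continuous fun v : Fin 2 → E => v 0 := continuous_apply 0
      have h1 : Continuous fun v : Fin 2 → E => v 1 := continuous_apply 1
      exact (B.continuous.comp h0).clm_apply h1
    map_eq_zero_of_eq' := by
      intro v i j hv hij
      have key : ∀ u : TangentSpace IM x, g.inner x (A x u) u = 0 := by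
        intro u
        have h1 := h x u u
        have h2 := g.symm x u (A x u)
        linarith
      have h01 : v 0 = v 1 := by
        fin_cases i <;> fin_cases j <;> simp_all
      change g.inner x (A x (v 0)) (v 1) = 0
      rw [h01]
      exact key _ }

/-- The torsion `3`-form `A dω_A`, that is `(X, Y, Z) ↦ dω_A (A X, A Y, A Z)`, of the Bismut
connection of the Hermitian structure `(g, A)`; it equals `-dᶜω_A`. -/
def bismutTorsion (g : SmoothMetric IM M) (A : EndField IM M) (h : g.IsSkew A) :
    FormField IM M 3 :=
  A.act (fundamentalForm g A h).extDer

/-- The Levi-Civita connection `g (∇_X Y, Z)` of `g`, given by the Koszul formula. -/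
def leviCivita (g : SmoothMetric IM M) (X Y Z : TangentField IM M) (x : M) : ℝ :=
  (1 / 2 : ℝ) *
    (mvfderiv IM (fun y => g.inner y (Y y) (Z y)) x (X x)
      + mvfderiv IM (fun y => g.inner y (X y) (Z y)) x (Y x)
      - mvfderiv IM (fun y => g.inner y (X y) (Y y)) x (Z x)
      + g.inner x (VectorField.mlieBracket IM X Y x) (Z x)
      - g.inner x (VectorField.mlieBracket IM X Z x) (Y x)
      - g.inner x (VectorField.mlieBracket IM Y Z x) (X x))

/-- The Bismut connection `g (∇ᴮ_X Y, Z) = g (∇_X Y, Z) - ½ dᶜω_A (X, Y, Z)` of the Hermitian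
structure `(g, A)`, where `-dᶜω_A = A dω_A`. -/
def bismutConnection (g : SmoothMetric IM M) (A : EndField IM M) (h : g.IsSkew A)
    (X Y Z : TangentField IM M) (x : M) : ℝ :=
  leviCivita g X Y Z x + (1 / 2 : ℝ) * bismutTorsion g A h x ![X x, Y x, Z x]

variable (IM M) in
/-- A hyperhermitian structure `(I, J, K, g)`: three complex structures satisfying the imaginary
quaternionic relations, and a Riemannian metric for which they are skew. -/
structure HyperhermitianStructure where
  I : EndField IM M
  J : EndField IM M
  K : EndField IM M
  g : SmoothMetric IM M
  complex_I : IsComplexStructure I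
  complex_J : IsComplexStructure J
  complex_K : IsComplexStructure K
  I_mul_J : ∀ (x : M) (v : TangentSpace IM x), I x (J x v) = K x v
  J_mul_I : ∀ (x : M) (v : TangentSpace IM x), J x (I x v) = -K x v
  skew_I : g.IsSkew I
  skew_J : g.IsSkew J
  skew_K : g.IsSkew K

namespace HyperhermitianStructure

variable (s : HyperhermitianStructure IM M)

/-- Hyperkähler: the three fundamental forms are closed. -/
structure IsHyperkahler : Prop where
  closed_I : (fundamentalForm s.g s.I s.skew_I).extDer = 0
  closed_J : (fundamentalForm s.g s.J s.skew_J).extDer = 0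
  closed_K : (fundamentalForm s.g s.K s.skew_K).extDer = 0

/-- HKT (hyperkähler with torsion): the Bismut connections of the three Hermitian structures
coincide. -/
def IsHKT : Prop :=
  ∀ X Y Z : TangentField IM M, X.IsSmooth → Y.IsSmooth → Z.IsSmooth → ∀ x : M,
    bismutConnection s.g s.I s.skew_I X Y Z x = bismutConnection s.g s.J s.skew_J X Y Z x ∧
    bismutConnection s.g s.J s.skew_J X Y Z x = bismutConnection s.g s.K s.skew_K X Y Z x

/-- Strong HKT: HKT with closed torsion `3`-form `H = I dω_I = J dω_J = K dω_K`. -/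
structure IsStrongHKT : Prop where
  hkt : s.IsHKT
  closed_torsion_I : (bismutTorsion s.g s.I s.skew_I).extDer = 0
  closed_torsion_J : (bismutTorsion s.g s.J s.skew_J).extDer = 0
  closed_torsion_K : (bismutTorsion s.g s.K s.skew_K).extDer = 0

/-- A hyperkähler isometry: a diffeomorphism that preserves the metric and is holomorphic for each
of the three complex structures. -/
structure IsHyperIsometry (ψ : M ≃ₘ^∞⟮IM, IM⟯ M) : Prop where
  metric : ∀ (x : M) (v w : TangentSpace IM x),
    s.g.inner (ψ x) (mfderiv IM IM ψ x v) (mfderiv IM IM ψ x w) = s.g.inner x v w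
  map_I : ∀ (x : M) (v : TangentSpace IM x),
    mfderiv IM IM ψ x (s.I x v) = s.I (ψ x) (mfderiv IM IM ψ x v)
  map_J : ∀ (x : M) (v : TangentSpace IM x),
    mfderiv IM IM ψ x (s.J x v) = s.J (ψ x) (mfderiv IM IM ψ x v)
  map_K : ∀ (x : M) (v : TangentSpace IM x),
    mfderiv IM IM ψ x (s.K x v) = s.K (ψ x) (mfderiv IM IM ψ x v)

end HyperhermitianStructure

end Hyperhermitian

/-! ### The mapping torus of a diffeomorphism -/

section MappingTorus

variable {E : Type*} [NormedAddCommGroup E] [NormedSpace ℝ E]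
  {H : Type*} [TopologicalSpace H] {IM : ModelWithCorners ℝ E H}
  {M : Type*} [TopologicalSpace M] [ChartedSpace H M]

/-- The action of `ℤ` on `M × ℝ` given by `n · (p, t) = (fⁿ p, t + n)`. -/
@[reducible]
def mappingTorusAction (f : M ≃ₘ^∞⟮IM, IM⟯ M) : AddAction ℤ (M × ℝ) where
  vadd n p := (((f.toEquiv : Equiv.Perm M) ^ n) p.1, p.2 + n)
  zero_vadd p := by
    change (((f.toEquiv : Equiv.Perm M) ^ (0 : ℤ)) p.1, p.2 + ((0 : ℤ) : ℝ)) = p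
    simp
  add_vadd m n p := by
    change (((f.toEquiv : Equiv.Perm M) ^ (m + n)) p.1, p.2 + ((m + n : ℤ) : ℝ)) =
      (((f.toEquiv : Equiv.Perm M) ^ m) (((f.toEquiv : Equiv.Perm M) ^ n) p.1),
        p.2 + (n : ℝ) + (m : ℝ))
    rw [zpow_add]
    simp only [Equiv.Perm.coe_mul, Function.comp_apply, Int.cast_add, Prod.mk.injEq, true_and]
    ring

/-- The mapping torus `M_f = (M × ℝ) / ℤ`. -/
def MappingTorus (f : M ≃ₘ^∞⟮IM, IM⟯ M) : Type _ :=
  Quotient (@AddAction.orbitRel ℤ (M × ℝ) _ (mappingTorusAction f))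

namespace MappingTorus

variable (f : M ≃ₘ^∞⟮IM, IM⟯ M)

/-- The quotient topology. -/
instance : TopologicalSpace (MappingTorus f) :=
  inferInstanceAs (TopologicalSpace (Quotient _))

/-- The quotient map `M × ℝ → M_f`. -/
def mk (p : M × ℝ) : MappingTorus f :=
  Quotient.mk _ p

/-- The diffeomorphism `(p, t) ↦ (fⁿ p, t + n)` of `M × ℝ`. -/
def deck (n : ℤ) (p : M × ℝ) : M × ℝ :=
  (((f.toEquiv : Equiv.Perm M) ^ n) p.1, p.2 + n)

theorem mk_surjective : Function.Surjective (mk f) := Quotient.mk_surjective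

theorem mk_eq_iff {p q : M × ℝ} : mk f p = mk f q ↔ ∃ n : ℤ, deck f n q = p := by
  exact Quotient.eq (r := @AddAction.orbitRel ℤ (M × ℝ) _ (mappingTorusAction f))

theorem contMDiff_zpow (n : ℤ) :
    ContMDiff IM IM ∞ (((f.toEquiv : Equiv.Perm M) ^ n : Equiv.Perm M) : M → M) := by
  have hpow : ∀ (g : Equiv.Perm M), ContMDiff IM IM ∞ g →
      ∀ k : ℕ, ContMDiff IM IM ∞ ((g ^ k : Equiv.Perm M) : M → M) := by
    intro g hg k
    induction k with
    | zero => simpa using contMDiff_id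
    | succ k ih => rw [pow_succ]; exact ih.comp hg
  cases n with
  | ofNat k => simpa using hpow f.toEquiv f.contMDiff k
  | negSucc k =>
    rw [zpow_negSucc, ← inv_pow]
    exact hpow _ f.symm.contMDiff _

theorem contMDiff_deck (n : ℤ) :
    ContMDiff (IM.prod 𝓘(ℝ, ℝ)) (IM.prod 𝓘(ℝ, ℝ)) ∞ (deck f n) := by
  refine ContMDiff.prodMk ((contMDiff_zpow f n).comp contMDiff_fst) ?_
  exact contMDiff_snd.add contMDiff_const

theorem isOpenMap_mk : IsOpenMap (mk f) := by
  intro U hU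
  change IsOpen (mk f ⁻¹' (mk f '' U))
  have : mk f ⁻¹' (mk f '' U) = ⋃ n : ℤ, deck f n ⁻¹' U := by
    ext p
    simp only [Set.mem_preimage, Set.mem_image, Set.mem_iUnion]
    constructor
    · rintro ⟨q, hq, hqp⟩
      obtain ⟨n, rfl⟩ := (mk_eq_iff f).1 hqp
      exact ⟨n, hq⟩
    · rintro ⟨n, hn⟩
      exact ⟨_, hn, (mk_eq_iff f).2 ⟨n, rfl⟩⟩
  rw [this]
  exact isOpen_iUnion fun n => hU.preimage (contMDiff_deck f n).continuous

theorem continuous_mk : Continuous (mk f) := continuous_quotient_mk'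

theorem isLocalHomeomorph_mk : IsLocalHomeomorph (mk f) := by
  refine isLocalHomeomorph_iff_isOpenEmbedding_restrict.2 fun p => ?_
  have hopen : IsOpen ((Set.univ : Set M) ×ˢ Set.Ioo (p.2 - 1 / 2) (p.2 + 1 / 2)) :=
    isOpen_univ.prod isOpen_Ioo
  refine ⟨_, hopen.mem_nhds ⟨trivial, by constructor <;> linarith⟩, ?_⟩
  refine Topology.IsOpenEmbedding.of_continuous_injective_isOpenMap
    ((continuous_mk f).comp continuous_subtype_val) ?_
    ((isOpenMap_mk f).comp hopen.isOpenMap_subtype_val)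
  intro x y hab
  obtain ⟨⟨a, s⟩, hs0, hs⟩ := x
  obtain ⟨⟨b, t⟩, ht0, ht⟩ := y
  obtain ⟨n, hn⟩ := (mk_eq_iff f (p := (a, s)) (q := (b, t))).1 hab
  have h2 : t + n = s := congrArg Prod.snd hn
  have h1 : ((f.toEquiv : Equiv.Perm M) ^ n) b = a := congrArg Prod.fst hn
  obtain ⟨hs1, hs2⟩ := hs
  obtain ⟨ht1, ht2⟩ := ht
  dsimp only at hs1 hs2 ht1 ht2
  have hn0 : n = 0 := by
    have h3 : (n : ℝ) < 1 := by linarith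
    have h4 : (-1 : ℝ) < n := by linarith
    have h5 : n < 1 := by exact_mod_cast h3
    have h6 : -1 < n := by exact_mod_cast h4
    omega
  subst hn0
  simp only [zpow_zero, Equiv.Perm.coe_one, id_eq, Int.cast_zero, add_zero] at h1 h2
  subst h1 h2
  rfl

/-- The charts of the mapping torus are the charts of `M × ℝ` composed with the local inverses
of the quotient map. -/
instance : ChartedSpace (ModelProd H ℝ) (MappingTorus f) :=
  (isLocalHomeomorph_mk f).chartedSpace (mk_surjective f)

theorem contMDiffAt_localInverse_comp_mk (q p : M × ℝ)
    (hp : mk f p ∈ ((isLocalHomeomorph_mk f).localInverseAt q).source) :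
    ContMDiffAt (IM.prod 𝓘(ℝ, ℝ)) (IM.prod 𝓘(ℝ, ℝ)) ∞
      ((isLocalHomeomorph_mk f).localInverseAt q ∘ mk f) p := by
  set L := (isLocalHomeomorph_mk f).localInverseAt q with hL
  have hmk : ∀ y ∈ L.source, mk f (L y) = y := fun y hy =>
    (isLocalHomeomorph_mk f).apply_localInverseAt_of_mem hy
  obtain ⟨n, hn⟩ := (mk_eq_iff f).1 (hmk _ hp)
  have hmem : deck f n p ∈ L.target := by
    rw [hn]
    exact L.map_source hp
  refine ((contMDiff_deck f n) p).congr_of_eventuallyEq ?_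
  have h1 : ∀ᶠ x in 𝓝 p, deck f n x ∈ L.target :=
    (contMDiff_deck f n).continuous.continuousAt.eventually_mem (L.open_target.mem_nhds hmem)
  have h2 : ∀ᶠ x in 𝓝 p, mk f x ∈ L.source :=
    (continuous_mk f).continuousAt.eventually_mem (L.open_source.mem_nhds hp)
  filter_upwards [h1, h2] with x hx1 hx2
  refine (isLocalHomeomorph_mk f).injOn_localInverseAt_target (L.map_source hx2) hx1 ?_
  rw [hmk _ hx2]
  exact ((mk_eq_iff f).2 ⟨n, rfl⟩).symm

/-- The mapping torus is a smooth manifold. -/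
instance [IsManifold IM ∞ M] : IsManifold (IM.prod 𝓘(ℝ, ℝ)) ∞ (MappingTorus f) := by
  have key : ∀ q q' : M × ℝ, ∀ z ∈ (((isLocalHomeomorph_mk f).localInverseAt q ≫ₕ
      chartAt (ModelProd H ℝ) q).symm ≫ₕ ((isLocalHomeomorph_mk f).localInverseAt q' ≫ₕ
      chartAt (ModelProd H ℝ) q')).source,
      ContMDiffAt (IM.prod 𝓘(ℝ, ℝ)) (IM.prod 𝓘(ℝ, ℝ)) ∞
        (((isLocalHomeomorph_mk f).localInverseAt q ≫ₕ
      chartAt (ModelProd H ℝ) q).symm ≫ₕ ((isLocalHomeomorph_mk f).localInverseAt q' ≫ₕ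
      chartAt (ModelProd H ℝ) q')) z := by
    intro q q' z hz
    simp only [OpenPartialHomeomorph.trans_source, OpenPartialHomeomorph.symm_source,
      OpenPartialHomeomorph.trans_target, OpenPartialHomeomorph.coe_trans_symm,
      IsLocalHomeomorph.localInverseAt_symm, Set.mem_inter_iff, Set.mem_preimage,
      Function.comp_apply] at hz
    obtain ⟨⟨hz1, -⟩, hz2, hz3⟩ := hz
    have a1 : ContMDiffAt (IM.prod 𝓘(ℝ, ℝ)) (IM.prod 𝓘(ℝ, ℝ)) ∞
        (chartAt (ModelProd H ℝ) q).symm z :=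
      contMDiffOn_chart_symm.contMDiffAt ((chartAt (ModelProd H ℝ) q).open_target.mem_nhds hz1)
    have a2 := contMDiffAt_localInverse_comp_mk f q' _ hz2
    have a3 : ContMDiffAt (IM.prod 𝓘(ℝ, ℝ)) (IM.prod 𝓘(ℝ, ℝ)) ∞
        (chartAt (ModelProd H ℝ) q')
        ((isLocalHomeomorph_mk f).localInverseAt q' (mk f ((chartAt (ModelProd H ℝ) q).symm z))) :=
      contMDiffOn_chart.contMDiffAt ((chartAt (ModelProd H ℝ) q').open_source.mem_nhds hz3)
    have a4 := ContMDiffAt.comp z (ContMDiffAt.comp _ a3 a2) a1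
    refine a4.congr_of_eventuallyEq (Filter.Eventually.of_forall fun y => ?_)
    simp
  refine isManifold_of_contDiffOn _ _ _ ?_
  rintro _ _ ⟨x, rfl⟩ ⟨x', rfl⟩
  rw [← contMDiffOn_iff_contDiffOn]
  refine (IM.prod 𝓘(ℝ, ℝ)).contMDiff.comp_contMDiffOn ?_
  refine ContMDiffOn.comp (t := (_ : OpenPartialHomeomorph _ _).source)
    (fun z hz => (key _ _ z hz).contMDiffWithinAt)
    ((IM.prod 𝓘(ℝ, ℝ)).contMDiffOn_symm.mono Set.inter_subset_right) fun y hy => hy.1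

end MappingTorus

end MappingTorus

end

/-!
Let `X = N_ψ × S³`. In polar coordinates `(t, q) ↦ eᵗ q`, the product `ℝ × S³` is the space of
nonzero quaternions. A local lift of `N_ψ` to `N × ℝ` thus gives a local diffeomorphism from `X` to
`N × (Quat \ {0})`, and two such local models differ by a map `(p, w) ↦ (ψⁿ p, eⁿ w)`
(`isModelAtlas_torusModel`).

On the nonzero quaternions, consider the metric `⟪·, ·⟫ / ‖w‖²` and the left multiplications by
`i, j, k`. Both are invariant under homotheties, so the product of this structure with the
hyperkähler structure of `N` is invariant under the changes of local models, and descends to `X`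
(`IsModelAtlas.glue`). The complex structures are integrable because left multiplications are
constant in linear coordinates (`IsModelAtlas.exists_holomorphic_chart`).

In a local model, the fundamental form is the sum of the pullbacks of the closed form of `N` and of
`β_L = ⟪L ·, ·⟫ / ‖w‖²`. Since the exterior derivative commutes with pullbacks
(`FormField.extDer_pullback`), the torsion form is the pullback of the torsion form of the
quaternionic factor (`IsModelAtlas.bismutTorsion_eq`). An explicit computation in coordinates shows
that the latter is the same for `L = i, j, k` (`conformalTorsion_quatJ`, `conformalTorsion_quatK`)
and that it is closed (`extDeriv_conformalTorsion`); it is the invariant volume form of `S³`, up to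
a constant. Equality of the torsion forms is equality of the Bismut connections.
-/

noncomputable section

/-! ### Smoothness of maps into finite-dimensional spaces -/

section FiniteDimensional

variable {E : Type*} [NormedAddCommGroup E] [NormedSpace ℝ E]
  {H : Type*} [TopologicalSpace H] {IM : ModelWithCorners ℝ E H}
  {M : Type*} [TopologicalSpace M] [ChartedSpace H M]

/-- A map into a finite-dimensional space is smooth as soon as its compositions with a family of
linear functionals separating points are: such a family spans the dual space. -/
theorem contMDiffAt_of_separating {W : Type*} [NormedAddCommGroup W] [NormedSpace ℝ W]
    [FiniteDimensional ℝ W] {ι : Type*} (l : ι → W →ₗ[ℝ] ℝ)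
    (hl : ∀ w, (∀ i, l i w = 0) → w = 0) {f : M → W} {x : M} {n : WithTop ℕ∞}
    (hf : ∀ i, ContMDiffAt IM 𝓘(ℝ, ℝ) n (fun y => l i (f y)) x) :
    ContMDiffAt IM 𝓘(ℝ, W) n f x := by
  have hspan : Submodule.span ℝ (Set.range l) = (⊤ : Submodule ℝ (Module.Dual ℝ W)) := by
    have h0 : (Submodule.span ℝ (Set.range l) :
        Submodule ℝ (Module.Dual ℝ W)).dualCoannihilator = ⊥ := by
      refine (Submodule.eq_bot_iff _).2 fun w hw => hl w fun i => ?_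
      exact (Submodule.mem_dualCoannihilator _ |>.1 hw) _ (Submodule.subset_span ⟨i, rfl⟩)
    rw [← Subspace.dualCoannihilator_dualAnnihilator_eq
      (W := Submodule.span ℝ (Set.range l)), h0, Submodule.dualAnnihilator_bot]
  have hall : ∀ φ : Module.Dual ℝ W, ContMDiffAt IM 𝓘(ℝ, ℝ) n (fun y => φ (f y)) x := by
    intro φ
    have hφ : φ ∈ Submodule.span ℝ (Set.range l) := hspan ▸ Submodule.mem_top
    induction hφ using Submodule.span_induction with
    | mem φ h => obtain ⟨i, rfl⟩ := h; exact hf i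
    | zero => exact contMDiffAt_const
    | add φ ψ _ _ h1 h2 => exact h1.add h2
    | smul c φ _ h => exact contMDiffAt_const.mul h
  let b := Module.finBasis ℝ W
  let e : W ≃L[ℝ] (Fin (Module.finrank ℝ W) → ℝ) := b.equivFun.toContinuousLinearEquiv
  have h1 : ContMDiffAt IM 𝓘(ℝ, Fin (Module.finrank ℝ W) → ℝ) n (fun y => e (f y)) x :=
    contMDiffAt_pi_space.2 fun i => hall (b.coord i)
  have h2 := e.symm.toContinuousLinearMap.contMDiff.contMDiffAt.comp x h1
  exact h2.congr_of_eventuallyEq (Filter.Eventually.of_forall fun y => by simp)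

theorem finiteDimensional_continuousAlternatingMap [FiniteDimensional ℝ E] (k : ℕ) :
    FiniteDimensional ℝ (E [⋀^Fin k]→L[ℝ] ℝ) := by
  let j : (E [⋀^Fin k]→L[ℝ] ℝ) →ₗ[ℝ] MultilinearMap ℝ (fun _ : Fin k => E) ℝ :=
    { toFun := fun a => a.toContinuousMultilinearMap.toMultilinearMap
      map_add' := fun _ _ => rfl
      map_smul' := fun _ _ => rfl }
  refine FiniteDimensional.of_injective j fun a b h => ?_
  ext v
  exact congrArg (fun m : MultilinearMap ℝ (fun _ : Fin k => E) ℝ => m v) h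

/-- In finite dimension, differentiability of a form can be tested on vectors. -/
theorem differentiableAt_continuousAlternatingMap [FiniteDimensional ℝ E] {k : ℕ}
    {G : Type*} [NormedAddCommGroup G] [NormedSpace ℝ G]
    {a : G → E [⋀^Fin k]→L[ℝ] ℝ} {y : G} (h : ∀ v, ContDiffAt ℝ ∞ (fun z => a z v) y) :
    DifferentiableAt ℝ a y := by
  have := finiteDimensional_continuousAlternatingMap (E := E) k
  let l : (Fin k → E) → (E [⋀^Fin k]→L[ℝ] ℝ) →ₗ[ℝ] ℝ := fun v =>
    { toFun := fun a => a v, map_add' := fun _ _ => rfl, map_smul' := fun _ _ => rfl }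
  have : ContMDiffAt 𝓘(ℝ, G) 𝓘(ℝ, E [⋀^Fin k]→L[ℝ] ℝ) ∞ a y :=
    contMDiffAt_of_separating l (fun w hw => ContinuousAlternatingMap.ext hw)
      fun v => (h v).contMDiffAt
  exact this.contDiffAt.differentiableAt (by simp)

end FiniteDimensional

/-! ### Pullback of differential forms -/

section Pullback

variable {E : Type*} [NormedAddCommGroup E] [NormedSpace ℝ E]
  {H : Type*} [TopologicalSpace H] {IM : ModelWithCorners ℝ E H}
  {M : Type*} [TopologicalSpace M] [ChartedSpace H M]
  {E' : Type*} [NormedAddCommGroup E'] [NormedSpace ℝ E']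
  {H' : Type*} [TopologicalSpace H'] {IM' : ModelWithCorners ℝ E' H'}
  {M' : Type*} [TopologicalSpace M'] [ChartedSpace H' M'] {k : ℕ}

namespace FormField

/-- Differentiability of a form at a point, in the preferred chart at that point. -/
def DiffAt (a : FormField IM M k) (x : M) : Prop :=
  DifferentiableAt ℝ (a.inChart x) (extChartAt IM x x)

/-- The pullback of a form under a map. -/
def pullback (IM : ModelWithCorners ℝ E H) (f : M → M') (a : FormField IM' M' k) :
    FormField IM M k :=
  fun x => (a (f x)).compContinuousLinearMap (mfderiv IM IM' f x)

/-- Congruence in the base point, whose tangent space is the model space. -/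
theorem compContinuousLinearMap_congr (a : FormField IM' M' k) {p q : M'} (h : p = q)
    {A B : E →L[ℝ] E'} (hAB : A = B) :
    ((a p).compContinuousLinearMap (A : E →L[ℝ] TangentSpace IM' p) : E [⋀^Fin k]→L[ℝ] ℝ) =
      (a q).compContinuousLinearMap (B : E →L[ℝ] TangentSpace IM' q) := by
  subst h hAB
  rfl

theorem inChart_congr {a b : FormField IM M k} {x : M} [IM.Boundaryless]
    (h : ∀ᶠ y in 𝓝 x, a y = b y) :
    a.inChart x =ᶠ[𝓝 (extChartAt IM x x)] b.inChart x := by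
  have hc : Filter.Tendsto (extChartAt IM x).symm (𝓝 (extChartAt IM x x)) (𝓝 x) := by
    simpa using (continuousAt_extChartAt_symm (I := IM) x).tendsto
  filter_upwards [hc.eventually h] with y hy
  simp only [inChart, hy]

theorem extDer_congr {a b : FormField IM M k} {x : M} [IM.Boundaryless]
    (h : ∀ᶠ y in 𝓝 x, a y = b y) :
    a.extDer x = b.extDer x := by
  simp only [extDer, (inChart_congr h).extDeriv_eq]

theorem extDer_add {a b : FormField IM M k} {x : M} (ha : a.DiffAt x) (hb : b.DiffAt x) :
    (a + b).extDer x = a.extDer x + b.extDer x := by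
  have h : (a + b).inChart x = a.inChart x + b.inChart x := by
    ext y v
    rfl
  simp only [extDer]
  rw [h, extDeriv_add ha hb]
  rfl

section Chart

theorem _root_.ContMDiffAt.eventually_mdifferentiableAt [IsManifold IM ∞ M] [IsManifold IM' ∞ M']
    {f : M → M'} {x : M} (hf : ContMDiffAt IM IM' ∞ f x) :
    ∀ᶠ y in 𝓝 x, MDifferentiableAt IM IM' f y := by
  have := IsManifold.of_le (I := IM) (M := M) (m := 1) (n := ∞) (by simp)
  have := IsManifold.of_le (I := IM') (M := M') (m := 1) (n := ∞) (by simp)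
  have h := (contMDiffAt_iff_contMDiffAt_nhds (n := 1) (by simp)).1 (hf.of_le (by simp))
  filter_upwards [h] with y hy using hy.mdifferentiableAt (by simp)

variable [IM.Boundaryless]

theorem contDiffAt_writtenInExtChartAt {f : M → M'} {x : M} (hf : ContMDiffAt IM IM' ∞ f x) :
    ContDiffAt ℝ ∞ (writtenInExtChartAt IM IM' x f) (extChartAt IM x x) := by
  have h := (contMDiffAt_iff.1 hf).2
  rwa [ModelWithCorners.Boundaryless.range_eq_univ, contDiffWithinAt_univ] at h

variable [IsManifold IM ∞ M] [IsManifold IM' ∞ M'] [IM'.Boundaryless]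

/-- In charts, the pullback of a form under `f` is the pullback of its coordinate expression under
the coordinate expression of `f`. -/
theorem inChart_pullback {f : M → M'} {x : M} (hf : ContMDiffAt IM IM' ∞ f x)
    (a : FormField IM' M' k) :
    (pullback IM f a).inChart x =ᶠ[𝓝 (extChartAt IM x x)] fun y =>
      (a.inChart (f x) (writtenInExtChartAt IM IM' x f y)).compContinuousLinearMap
        (fderiv ℝ (writtenInExtChartAt IM IM' x f) y) := by
  have hc : Filter.Tendsto (extChartAt IM x).symm (𝓝 (extChartAt IM x x)) (𝓝 x) := by
    simpa using (continuousAt_extChartAt_symm (I := IM) x).tendsto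
  have h1 := hf.eventually_mdifferentiableAt
  have h2 : ∀ᶠ z in 𝓝 x, f z ∈ (extChartAt IM' (f x)).source :=
    hf.continuousAt.eventually_mem (extChartAt_source_mem_nhds _)
  have h3 : ∀ᶠ y in 𝓝 (extChartAt IM x x), y ∈ (extChartAt IM x).target :=
    extChartAt_target_mem_nhds x
  have h4 := ((contDiffAt_writtenInExtChartAt hf).of_le (m := 1) (by simp)).eventually (by simp)
  filter_upwards [hc.eventually h1, (hc.eventually h2).eventually_nhds,
    h3, h4] with y hy1 hy2 hy3 hy4
  have hT : (fun z => (extChartAt IM' (f x)).symm (writtenInExtChartAt IM IM' x f z)) =ᶠ[𝓝 y]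
      fun z => f ((extChartAt IM x).symm z) := by
    filter_upwards [hy2] with z hz
    simp only [writtenInExtChartAt, Function.comp_apply]
    exact (extChartAt IM' (f x)).left_inv hz
  have hs : MDifferentiableAt 𝓘(ℝ, E) IM (extChartAt IM x).symm y := by
    have := mdifferentiableWithinAt_extChartAt_symm (I := IM) hy3
    rwa [ModelWithCorners.Boundaryless.range_eq_univ, mdifferentiableWithinAt_univ] at this
  have hs' : MDifferentiableAt 𝓘(ℝ, E') IM' (extChartAt IM' (f x)).symm
      (writtenInExtChartAt IM IM' x f y) := by
    have hm : writtenInExtChartAt IM IM' x f y ∈ (extChartAt IM' (f x)).target :=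
      (extChartAt IM' (f x)).map_source hy2.self_of_nhds
    have := mdifferentiableWithinAt_extChartAt_symm (I := IM') hm
    rwa [ModelWithCorners.Boundaryless.range_eq_univ, mdifferentiableWithinAt_univ] at this
  have e1 := mfderiv_comp y hy1 hs
  have e2 := mfderiv_comp y hs' (hy4.differentiableAt (by simp)).mdifferentiableAt
  have e3 := hT.mfderiv_eq (I := 𝓘(ℝ, E)) (I' := IM')
  have e4 : (mfderiv 𝓘(ℝ, E) 𝓘(ℝ, E') (writtenInExtChartAt IM IM' x f) y : E →L[ℝ] E') =
    fderiv ℝ (writtenInExtChartAt IM IM' x f) y := mfderiv_eq_fderiv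
  let S : E' →L[ℝ] E' := mfderiv 𝓘(ℝ, E') IM' (extChartAt IM' (f x)).symm
    (writtenInExtChartAt IM IM' x f y)
  let R : E →L[ℝ] E' := mfderiv IM IM' f ((extChartAt IM x).symm y)
  let R' : E →L[ℝ] E := mfderiv 𝓘(ℝ, E) IM (extChartAt IM x).symm y
  have e5 := congrArg (fun L : E →L[ℝ] E' => S.comp L) e4
  have := compContinuousLinearMap_congr (E := E) a hT.self_of_nhds.symm
    (A := R.comp R') (B := S.comp (fderiv ℝ (writtenInExtChartAt IM IM' x f) y))
    (((e1.symm.trans e3.symm).trans e2).trans e5)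
  exact this

theorem DiffAt.pullback {f : M → M'} {x : M} (hf : ContMDiffAt IM IM' ∞ f x)
    {a : FormField IM' M' k} (ha : a.DiffAt (f x)) : (a.pullback IM f).DiffAt x := by
  have hT := contDiffAt_writtenInExtChartAt hf
  refine DifferentiableAt.congr_of_eventuallyEq ?_ (inChart_pullback hf a)
  refine DifferentiableAt.continuousAlternatingMapCompContinuousLinearMap ?_ ?_
  · refine DifferentiableAt.comp (extChartAt IM x x) (g := a.inChart (f x)) ?_
      (hT.differentiableAt (by simp))
    simpa [DiffAt, writtenInExtChartAt] using ha
  · exact (hT.fderiv_right (m := ∞) (by simp)).differentiableAt (by simp)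

/-- The exterior derivative commutes with pullbacks. -/
theorem extDer_pullback {f : M → M'} {x : M} (hf : ContMDiffAt IM IM' ∞ f x)
    {a : FormField IM' M' k} (ha : a.DiffAt (f x)) :
    (a.pullback IM f).extDer x = a.extDer.pullback IM f x := by
  have hT := contDiffAt_writtenInExtChartAt hf
  have hTx : writtenInExtChartAt IM IM' x f (extChartAt IM x x) = extChartAt IM' (f x) (f x) := by
    simp [writtenInExtChartAt]
  have ha' : DifferentiableAt ℝ (a.inChart (f x))
      (writtenInExtChartAt IM IM' x f (extChartAt IM x x)) := by
    rw [hTx]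
    exact ha
  have h1 := extDeriv_pullback ha' hT
    (by rw [minSmoothness_of_isRCLikeNormedField]; exact WithTop.coe_le_coe.2 (le_top (a := 2)))
  have hx : MDifferentiableAt IM 𝓘(ℝ, E) (extChartAt IM x) x :=
    mdifferentiableAt_extChartAt (mem_chart_source H x)
  have hfx : MDifferentiableAt IM' 𝓘(ℝ, E') (extChartAt IM' (f x)) (f x) :=
    mdifferentiableAt_extChartAt (mem_chart_source H' (f x))
  have e1 := mfderiv_comp x hfx (hf.mdifferentiableAt (by simp))
  have e2 := mfderiv_comp x (hT.differentiableAt (by simp)).mdifferentiableAt hx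
  have e3 : (writtenInExtChartAt IM IM' x f ∘ extChartAt IM x) =ᶠ[𝓝 x]
      (extChartAt IM' (f x) ∘ f) := by
    filter_upwards [extChartAt_source_mem_nhds (I := IM) x] with z hz
    simp only [writtenInExtChartAt, Function.comp_apply, (extChartAt IM x).left_inv hz]
  have e4 := (e2.symm.trans (e3.mfderiv_eq (I := IM) (I' := 𝓘(ℝ, E')))).trans e1
  have e6 : (mfderiv 𝓘(ℝ, E) 𝓘(ℝ, E') (writtenInExtChartAt IM IM' x f)
      (extChartAt IM x x) : E →L[ℝ] E') =
    fderiv ℝ (writtenInExtChartAt IM IM' x f) (extChartAt IM x x) := mfderiv_eq_fderiv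
  simp only [extDer, FormField.pullback]
  rw [(inChart_pullback hf a).extDeriv_eq, h1, hTx]
  ext v
  have e5 : ∀ w, fderiv ℝ (writtenInExtChartAt IM IM' x f) (extChartAt IM x x)
      (mfderiv IM 𝓘(ℝ, E) (extChartAt IM x) x w) =
      mfderiv IM' 𝓘(ℝ, E') (extChartAt IM' (f x)) (f x) (mfderiv IM IM' f x w) :=
    fun w => (congrArg (fun L : E →L[ℝ] E' => L (mfderiv IM 𝓘(ℝ, E) (extChartAt IM x) x w))
      e6).symm.trans (congrArg (fun L : E →L[ℝ] E' => L w) e4)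
  exact congrArg (extDeriv (a.inChart (f x)) (extChartAt IM' (f x) (f x)))
    (funext fun i => e5 (v i))

end Chart

section NormedSpace

variable {V : Type*} [NormedAddCommGroup V] [NormedSpace ℝ V]

theorem inChart_normedSpace (b : FormField 𝓘(ℝ, V) V k) (w : V) : b.inChart w = b := by
  funext y
  have h : (mfderiv 𝓘(ℝ, V) 𝓘(ℝ, V) (extChartAt 𝓘(ℝ, V) w).symm y : V →L[ℝ] V) =
      ContinuousLinearMap.id ℝ V := by
    have : ((extChartAt 𝓘(ℝ, V) w).symm : V → V) = id := by
      rw [extChartAt_model_space_eq_id]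
      rfl
    rw [this]
    exact mfderiv_id
  have h' := compContinuousLinearMap_congr (E := V) b
    (show (extChartAt 𝓘(ℝ, V) w).symm y = y by
      rw [extChartAt_model_space_eq_id]
      rfl) h
  exact h'

theorem diffAt_normedSpace {b : FormField 𝓘(ℝ, V) V k} {w : V} :
    b.DiffAt w ↔ @DifferentiableAt ℝ _ V _ _ _ (V [⋀^Fin k]→L[ℝ] ℝ) _ _ _ b w := by
  rw [DiffAt, inChart_normedSpace]
  simp
  rfl

theorem extDer_normedSpace (b : FormField 𝓘(ℝ, V) V k) (w : V) :
    b.extDer w = @extDeriv ℝ V ℝ _ _ _ _ _ k b w := by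
  have h : (mvfderiv 𝓘(ℝ, V) (extChartAt 𝓘(ℝ, V) w) w : V →L[ℝ] V) =
      ContinuousLinearMap.id ℝ V := by
    have : (extChartAt 𝓘(ℝ, V) w : V → V) = id := by
      rw [extChartAt_model_space_eq_id]
      rfl
    rw [this]
    exact mfderiv_id
  rw [extDer, inChart_normedSpace]
  ext v
  exact congrArg (@extDeriv ℝ V ℝ _ _ _ _ _ k b w)
    (funext fun i => congrArg (fun L : V →L[ℝ] V => L (v i)) h)

end NormedSpace

end FormField

end Pullback

/-! ### Testing the smoothness of tensor fields on vector fields -/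

section Tensors

variable {E : Type*} [NormedAddCommGroup E] [NormedSpace ℝ E]
  {H : Type*} [TopologicalSpace H] {IM : ModelWithCorners ℝ E H}
  {M : Type*} [TopologicalSpace M] [ChartedSpace H M] [IsManifold IM ∞ M]

/-- Smoothness at a point of a vector field. -/
def TangentField.SmoothAt (v : TangentField IM M) (x : M) : Prop :=
  ContMDiffAt IM IM.tangent ∞ (fun y => (⟨y, v y⟩ : TangentBundle IM M)) x

/-- Constant vectors in the trivialization of the tangent bundle at `x`. -/
def constField (IM : ModelWithCorners ℝ E H) [IsManifold IM ∞ M] (x : M) (u : E) :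
    TangentField IM M :=
  fun y => (trivializationAt E (fun z : M => TangentSpace IM z) x).symmL ℝ y u

theorem constField_apply {x y : M} (hy : y ∈ (trivializationAt E (fun z : M => TangentSpace IM z)
    x).baseSet) (u : E) : constField IM x u y =
      (trivializationAt E (fun z : M => TangentSpace IM z) x).symm y u :=
  Bundle.Trivialization.symmL_apply _ hy u

theorem constField_smoothAt (x : M) (u : E) : (constField IM x u).SmoothAt x := by
  refine (Bundle.contMDiffAt_section (E := (fun y : M => TangentSpace IM y)) x).2 ?_
  refine (contMDiffAt_const (c := u)).congr_of_eventuallyEq ?_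
  filter_upwards [(trivializationAt E (fun y : M => TangentSpace IM y) x).open_baseSet.mem_nhds
    (FiberBundle.mem_baseSet_trivializationAt' x)] with y hy
  simp [constField_apply hy, Bundle.Trivialization.apply_mk_symm _ hy]

/-- An endomorphism field is smooth at `x` if it maps smooth vector fields to smooth ones. -/
theorem contMDiffAt_endField [FiniteDimensional ℝ E] {A : EndField IM M} {x : M}
    (h : ∀ v : TangentField IM M, v.SmoothAt x → TangentField.SmoothAt (fun y => A y (v y)) x) :
    ContMDiffAt IM (IM.prod 𝓘(ℝ, E →L[ℝ] E)) ∞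
      (fun x => (⟨x, A x⟩ : Bundle.TotalSpace (E →L[ℝ] E)
        (fun x : M => TangentSpace IM x →L[ℝ] TangentSpace IM x))) x := by
  rw [contMDiffAt_hom_bundle]
  refine ⟨contMDiffAt_id, ?_⟩
  let l : E × Module.Dual ℝ E → (E →L[ℝ] E) →ₗ[ℝ] ℝ := fun p =>
    { toFun := fun a => p.2 (a p.1)
      map_add' := by simp
      map_smul' := by simp }
  refine contMDiffAt_of_separating l (fun w hw => ?_) fun p => ?_
  · ext u
    exact (Module.forall_dual_apply_eq_zero_iff ℝ _).1 fun φ => hw (u, φ)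
  · have h1 := h _ (constField_smoothAt x p.1)
    have h2 := (Bundle.contMDiffAt_totalSpace.1 h1).2
    have h3 := (LinearMap.toContinuousLinearMap p.2).contMDiff.contMDiffAt.comp x h2
    refine h3.congr_of_eventuallyEq ?_
    filter_upwards [(trivializationAt E (fun y : M => TangentSpace IM y) x).open_baseSet.mem_nhds
      (FiberBundle.mem_baseSet_trivializationAt' x)] with y hy
    change p.2 _ = p.2 _
    congr 1
    rw [ContinuousLinearMap.inCoordinates_eq hy hy]
    simp [constField_apply hy]

set_option synthInstance.maxHeartbeats 100000 in
/-- A field of bilinear forms is smooth at `x` if its values on smooth vector fields are. -/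
theorem contMDiffAt_bilinField [FiniteDimensional ℝ E]
    {g : (y : M) → TangentSpace IM y →L[ℝ] TangentSpace IM y →L[ℝ] ℝ}
    {x : M} (h : ∀ v w : TangentField IM M, v.SmoothAt x → w.SmoothAt x →
      ContMDiffAt IM 𝓘(ℝ, ℝ) ∞ (fun y => g y (v y) (w y)) x) :
    ContMDiffAt IM (IM.prod 𝓘(ℝ, E →L[ℝ] E →L[ℝ] ℝ)) ∞
      (fun y => Bundle.TotalSpace.mk' (E →L[ℝ] E →L[ℝ] ℝ)
        (E := fun y : M => TangentSpace IM y →L[ℝ] TangentSpace IM y →L[ℝ] ℝ) y (g y)) x := by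
  rw [contMDiffAt_hom_bundle]
  refine ⟨contMDiffAt_id, ?_⟩
  let l : E × E → (E →L[ℝ] E →L[ℝ] ℝ) →ₗ[ℝ] ℝ := fun p =>
    { toFun := fun a => a p.1 p.2
      map_add' := by simp
      map_smul' := by simp }
  refine contMDiffAt_of_separating l (fun w hw => ?_) fun p => ?_
  · ext u u'
    exact hw (u, u')
  · have h1 := h _ _ (constField_smoothAt x p.1) (constField_smoothAt x p.2)
    refine h1.congr_of_eventuallyEq ?_
    filter_upwards [(trivializationAt E (fun y : M => TangentSpace IM y) x).open_baseSet.mem_nhds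
      (FiberBundle.mem_baseSet_trivializationAt' x)] with y hy
    refine (inCoordinates_apply_eq₂ (E₃ := Bundle.Trivial M ℝ) hy hy (by simp)).trans ?_
    simp [constField_apply hy]

/-- The application of a smooth metric to smooth vector fields along a map. -/
theorem SmoothMetric.contMDiffAt_apply {E' : Type*} [NormedAddCommGroup E'] [NormedSpace ℝ E']
    {H' : Type*} [TopologicalSpace H'] {IM' : ModelWithCorners ℝ E' H'}
    {M' : Type*} [TopologicalSpace M'] [ChartedSpace H' M'] (g : SmoothMetric IM M)
    {b : M' → M} {v w : (y : M') → TangentSpace IM (b y)} {x : M'}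
    (hv : ContMDiffAt IM' IM.tangent ∞ (fun y => (⟨b y, v y⟩ : TangentBundle IM M)) x)
    (hw : ContMDiffAt IM' IM.tangent ∞ (fun y => (⟨b y, w y⟩ : TangentBundle IM M)) x) :
    ContMDiffAt IM' 𝓘(ℝ, ℝ) ∞ (fun y => g.inner (b y) (v y) (w y)) x := by
  have hb : ContMDiffAt IM' IM ∞ b x := (Bundle.contMDiffAt_totalSpace.1 hv).1
  have hg := (g.contMDiff (b x)).comp x hb
  have := ContMDiffAt.clm_bundle_apply₂ (E₃ := Bundle.Trivial M ℝ) (F₃ := ℝ)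
    (ψ := fun y => g.inner (b y)) hg hv hw
  exact (Bundle.contMDiffAt_totalSpace.1 this).2

/-- The application of a smooth endomorphism field to a smooth vector field along a map. -/
theorem EndField.IsSmooth.contMDiffAt_apply
    {E' : Type*} [NormedAddCommGroup E'] [NormedSpace ℝ E']
    {H' : Type*} [TopologicalSpace H'] {IM' : ModelWithCorners ℝ E' H'}
    {M' : Type*} [TopologicalSpace M'] [ChartedSpace H' M'] {A : EndField IM M} (hA : A.IsSmooth)
    {b : M' → M} {v : (y : M') → TangentSpace IM (b y)} {x : M'}
    (hv : ContMDiffAt IM' IM.tangent ∞ (fun y => (⟨b y, v y⟩ : TangentBundle IM M)) x) :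
    ContMDiffAt IM' IM.tangent ∞ (fun y => (⟨b y, A (b y) (v y)⟩ : TangentBundle IM M)) x := by
  have hb : ContMDiffAt IM' IM ∞ b x := (Bundle.contMDiffAt_totalSpace.1 hv).1
  have hg := (hA (b x)).comp x hb
  exact ContMDiffAt.clm_bundle_apply (ϕ := fun y => A (b y)) hg hv

/-- The differential of a smooth map, applied to a smooth vector field along a map. -/
theorem contMDiffAt_mfderiv_apply
    {E' : Type*} [NormedAddCommGroup E'] [NormedSpace ℝ E']
    {H' : Type*} [TopologicalSpace H'] {IM' : ModelWithCorners ℝ E' H'}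
    {M' : Type*} [TopologicalSpace M'] [ChartedSpace H' M'] [IsManifold IM' ∞ M']
    {E'' : Type*} [NormedAddCommGroup E''] [NormedSpace ℝ E'']
    {H'' : Type*} [TopologicalSpace H''] {IM'' : ModelWithCorners ℝ E'' H''}
    {M'' : Type*} [TopologicalSpace M''] [ChartedSpace H'' M'']
    {f : M → M'} {b : M'' → M} {v : (y : M'') → TangentSpace IM (b y)} {x : M''}
    (hf : ContMDiffAt IM IM' ∞ f (b x))
    (hv : ContMDiffAt IM'' IM.tangent ∞ (fun y => (⟨b y, v y⟩ : TangentBundle IM M)) x) :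
    ContMDiffAt IM'' IM'.tangent ∞
      (fun y => (⟨f (b y), mfderiv IM IM' f (b y) (v y)⟩ : TangentBundle IM' M')) x := by
  have hb : ContMDiffAt IM'' IM ∞ b x := (Bundle.contMDiffAt_totalSpace.1 hv).1
  have h1 := hf.mfderiv_const (m := ∞) (by simp)
  have h2 := h1.comp x hb
  exact ContMDiffAt.clm_apply_of_inCoordinates (ϕ := fun y => mfderiv IM IM' f (b y)) h2 hv
    (hf.comp x hb)

/-- The coordinate expression of the fundamental form of a smooth `A` is differentiable: evaluated
on constant vectors, it is the fundamental form of the corresponding fields `constField`. -/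
theorem fundamentalForm_diffAt [FiniteDimensional ℝ E] [IM.Boundaryless] (g : SmoothMetric IM M)
    {A : EndField IM M}
    (hA : A.IsSmooth) (h : g.IsSkew A) (x : M) : (fundamentalForm g A h).DiffAt x := by
  refine differentiableAt_continuousAlternatingMap fun u => ?_
  have h0 : ∀ i, (constField IM x (u i)).SmoothAt x := fun i => constField_smoothAt x (u i)
  have h1 : ContMDiffAt IM 𝓘(ℝ, ℝ) ∞ (fun y => g.inner y (A y (constField IM x (u 0) y))
      (constField IM x (u 1) y)) x :=
    g.contMDiffAt_apply (b := id) (hA.contMDiffAt_apply (b := id) (h0 0)) (h0 1)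
  have hs : ContMDiffAt 𝓘(ℝ, E) IM ∞ (extChartAt IM x).symm (extChartAt IM x x) := by
    exact (contMDiffOn_extChartAt_symm x).contMDiffAt (extChartAt_target_mem_nhds x)
  have h2 := (ContMDiffAt.comp_of_eq h1 hs (by simp)).contDiffAt
  refine h2.congr_of_eventuallyEq ?_
  filter_upwards [extChartAt_target_mem_nhds (I := IM) x] with y hy
  have hy' : (extChartAt IM x).symm y ∈ (chartAt H x).source := by
    simpa using (extChartAt IM x).map_target hy
  have e1 := TangentBundle.symmL_trivializationAt (I := IM) hy'
  rw [(extChartAt IM x).right_inv hy, ModelWithCorners.Boundaryless.range_eq_univ,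
    mfderivWithin_univ] at e1
  have e2 : ∀ i, constField IM x (u i) ((extChartAt IM x).symm y) =
      mfderiv 𝓘(ℝ, E) IM (extChartAt IM x).symm y (u i) := fun i =>
    congrArg (fun L : E →L[ℝ] E => L (u i)) e1
  simp only [Function.comp_apply, e2]
  rfl

end Tensors

/-! ### The quaternions and their conformally flat HKT structure -/

section Quaternions

/-- The quaternions, with their Euclidean structure; `x 0 + x 1 i + x 2 j + x 3 k` has
coordinates `x`. -/
abbrev Quat : Type := EuclideanSpace ℝ (Fin 4)

/-- Left multiplication by `i`. -/
def quatI : Quat →L[ℝ] Quat := LinearMap.toContinuousLinearMap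
  { toFun := fun x => !₂[-x 1, x 0, -x 3, x 2]
    map_add' := fun x y => by ext i; fin_cases i <;> simp <;> ring
    map_smul' := fun c x => by ext i; fin_cases i <;> simp }

/-- Left multiplication by `j`. -/
def quatJ : Quat →L[ℝ] Quat := LinearMap.toContinuousLinearMap
  { toFun := fun x => !₂[-x 2, x 3, x 0, -x 1]
    map_add' := fun x y => by ext i; fin_cases i <;> simp <;> ring
    map_smul' := fun c x => by ext i; fin_cases i <;> simp }

/-- Left multiplication by `k`. -/
def quatK : Quat →L[ℝ] Quat := LinearMap.toContinuousLinearMap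
  { toFun := fun x => !₂[-x 3, -x 2, x 1, x 0]
    map_add' := fun x y => by ext i; fin_cases i <;> simp <;> ring
    map_smul' := fun c x => by ext i; fin_cases i <;> simp }

theorem quatI_apply (x : Quat) : quatI x = !₂[-x 1, x 0, -x 3, x 2] := rfl

theorem quatJ_apply (x : Quat) : quatJ x = !₂[-x 2, x 3, x 0, -x 1] := rfl

theorem quatK_apply (x : Quat) : quatK x = !₂[-x 3, -x 2, x 1, x 0] := rfl

theorem quat_inner (x y : Quat) :
    inner ℝ x y = x 0 * y 0 + x 1 * y 1 + x 2 * y 2 + x 3 * y 3 := by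
  simp only [PiLp.inner_apply, Fin.sum_univ_four, RCLike.inner_apply, conj_trivial]
  ring

/-- An orthogonal complex structure on the quaternions, together with complex coordinates. -/
structure IsQuatComplexStructure (L : Quat →L[ℝ] Quat) : Prop where
  sq : ∀ v, L (L v) = -v
  skew : ∀ v w, inner ℝ (L v) w = -inner ℝ v (L w)
  coord : ∃ C : Quat ≃L[ℝ] (Fin 2 → ℂ), ∀ v, C (L v) = Complex.I • C v

/-- For a permutation `σ`, the real linear isomorphism with `ℂ²` given by the complex coordinates
`x (σ 0) + i x (σ 1)` and `x (σ 2) + i x (σ 3)`. -/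
theorem exists_quat_complex_coord {σ : Fin 4 → Fin 4} (hσ : Function.Surjective σ) :
    ∃ C : Quat ≃L[ℝ] (Fin 2 → ℂ), ∀ v,
      C v = ![⟨v (σ 0), v (σ 1)⟩, ⟨v (σ 2), v (σ 3)⟩] := by
  let l : Quat →ₗ[ℝ] (Fin 2 → ℂ) :=
    { toFun := fun v => ![⟨v (σ 0), v (σ 1)⟩, ⟨v (σ 2), v (σ 3)⟩]
      map_add' := fun x y => by ext i; fin_cases i <;> apply Complex.ext <;> simp
      map_smul' := fun c x => by ext i; fin_cases i <;> apply Complex.ext <;> simp }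
  have hl : Function.Injective l := by
    refine (injective_iff_map_eq_zero l).2 fun v hv => ?_
    have h0 := congrArg Complex.re (congrFun hv 0)
    have h1 := congrArg Complex.im (congrFun hv 0)
    have h2 := congrArg Complex.re (congrFun hv 1)
    have h3 := congrArg Complex.im (congrFun hv 1)
    ext i
    obtain ⟨j, rfl⟩ := hσ i
    fin_cases j
    · exact h0
    · exact h1
    · exact h2
    · exact h3
  exact ⟨(LinearEquiv.ofInjectiveOfFinrankEq l hl
    (by simp [Module.finrank_pi_fintype, Complex.finrank_real_complex])).toContinuousLinearEquiv,
    fun v => rfl⟩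

theorem isQuatComplexStructure_quatI : IsQuatComplexStructure quatI where
  sq v := by ext i; fin_cases i <;> simp [quatI_apply]
  skew v w := by simp [quatI_apply, quat_inner]; ring
  coord := by
    obtain ⟨C, hC⟩ := exists_quat_complex_coord (σ := id) Function.surjective_id
    refine ⟨C, fun v => ?_⟩
    rw [hC, hC]
    ext i
    fin_cases i <;> apply Complex.ext <;> simp [quatI_apply]

theorem isQuatComplexStructure_quatJ : IsQuatComplexStructure quatJ where
  sq v := by ext i; fin_cases i <;> simp [quatJ_apply]
  skew v w := by simp [quatJ_apply, quat_inner]; ring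
  coord := by
    -- the complex coordinates are `x 0 + i x 2` and `x 3 + i x 1`
    obtain ⟨C, hC⟩ := exists_quat_complex_coord (σ := ![0, 2, 3, 1]) (by decide)
    refine ⟨C, fun v => ?_⟩
    rw [hC, hC]
    ext i
    fin_cases i <;> apply Complex.ext <;> simp [quatJ_apply]

theorem isQuatComplexStructure_quatK : IsQuatComplexStructure quatK where
  sq v := by ext i; fin_cases i <;> simp [quatK_apply]
  skew v w := by simp [quatK_apply, quat_inner]; ring
  coord := by
    -- the complex coordinates are `x 0 + i x 3` and `x 1 + i x 2`
    obtain ⟨C, hC⟩ := exists_quat_complex_coord (σ := ![0, 3, 1, 2]) (by decide)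
    refine ⟨C, fun v => ?_⟩
    rw [hC, hC]
    ext i
    fin_cases i <;> apply Complex.ext <;> simp [quatK_apply]

theorem quatI_quatJ (v : Quat) : quatI (quatJ v) = quatK v := by
  ext i; fin_cases i <;> simp [quatI_apply, quatJ_apply, quatK_apply]

theorem quatJ_quatI (v : Quat) : quatJ (quatI v) = -quatK v := by
  ext i; fin_cases i <;> simp [quatI_apply, quatJ_apply, quatK_apply]

/-- The constant `2`-form `(u, v) ↦ ⟪L u, v⟫`. -/
def quatForm {L : Quat →L[ℝ] Quat} (hL : IsQuatComplexStructure L) : Quat [⋀^Fin 2]→L[ℝ] ℝ where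
  toFun v := inner ℝ (L (v 0)) (v 1)
  map_update_add' := by
    intro _ m i a b
    fin_cases i <;> simp [Function.update, inner_add_left, inner_add_right]
  map_update_smul' := by
    intro _ m i c a
    fin_cases i <;> simp [Function.update, inner_smul_left, inner_smul_right]
  cont := by fun_prop
  map_eq_zero_of_eq' := by
    intro v i j hv hij
    have key : ∀ u : Quat, inner ℝ (L u) u = 0 := by
      intro u
      have h1 := hL.skew u u
      have h2 := real_inner_comm u (L u)
      linarith
    have h01 : v 0 = v 1 := by
      fin_cases i <;> fin_cases j <;> simp_all
    change inner ℝ (L (v 0)) (v 1) = 0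
    rw [h01]
    exact key _

/-- The fundamental form of `L` and the conformally flat metric `⟪·, ·⟫ / ‖w‖²`. -/
def conformalForm {L : Quat →L[ℝ] Quat} (hL : IsQuatComplexStructure L) (w : Quat) :
    Quat [⋀^Fin 2]→L[ℝ] ℝ :=
  (inner ℝ w w)⁻¹ • quatForm hL

variable {L : Quat →L[ℝ] Quat} (hL : IsQuatComplexStructure L)

theorem conformalForm_differentiableAt {w : Quat} (hw : w ≠ 0) :
    DifferentiableAt ℝ (conformalForm hL) w := by
  have h : (inner ℝ w w : ℝ) ≠ 0 := by simpa using hw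
  exact ((((differentiableAt_id).inner ℝ differentiableAt_id).inv h).smul_const (quatForm hL))

theorem extDeriv_conformalForm {w : Quat} (hw : w ≠ 0) (u : Fin 3 → Quat) :
    extDeriv (conformalForm hL) w u = -2 * ((inner ℝ w w)⁻¹) ^ 2 *
      (inner ℝ w (u 0) * inner ℝ (L (u 1)) (u 2) - inner ℝ w (u 1) * inner ℝ (L (u 0)) (u 2)
        + inner ℝ w (u 2) * inner ℝ (L (u 0)) (u 1)) := by
  have h : (inner ℝ w w : ℝ) ≠ 0 := by simpa using hw
  have hd : ∀ v : Fin 2 → Quat, ∀ d : Quat, fderiv ℝ (fun z => conformalForm hL z v) w d =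
      -2 * ((inner ℝ w w)⁻¹) ^ 2 * inner ℝ w d * inner ℝ (L (v 0)) (v 1) := by
    intro v d
    have h1 : HasFDerivAt (fun z : Quat => inner ℝ z z) _ w :=
      (hasFDerivAt_id w).inner ℝ (hasFDerivAt_id w)
    have h2 := ((hasDerivAt_inv h).comp_hasFDerivAt (f := fun z : Quat => inner ℝ z z) w
      h1).mul_const (inner ℝ (L (v 0)) (v 1))
    have h3 : fderiv ℝ (fun z => conformalForm hL z v) w = _ := h2.fderiv
    rw [h3]
    simp [real_inner_comm w d]
    ring
  rw [extDeriv_apply (conformalForm_differentiableAt hL hw)]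
  refine (Fin.sum_univ_three _).trans ?_
  simp only [hd]
  simp [Fin.removeNth, Fin.succAbove]
  ring

/-- The torsion form of the conformally flat Hermitian structure given by `L`. -/
def conformalTorsion (w : Quat) : Quat [⋀^Fin 3]→L[ℝ] ℝ :=
  (extDeriv (conformalForm hL) w).compContinuousLinearMap L

theorem conformalTorsion_apply {w : Quat} (hw : w ≠ 0) (u : Fin 3 → Quat) :
    conformalTorsion hL w u = -2 * ((inner ℝ w w)⁻¹) ^ 2 *
      (inner ℝ w (L (u 0)) * inner ℝ (L (u 1)) (u 2)
        - inner ℝ w (L (u 1)) * inner ℝ (L (u 0)) (u 2)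
        + inner ℝ w (L (u 2)) * inner ℝ (L (u 0)) (u 1)) := by
  have h : ∀ a b, inner ℝ (L (L a)) (L b) = inner ℝ (L a) b := fun a b => by
    rw [hL.sq, inner_neg_left, hL.skew a b]
  rw [conformalTorsion, ContinuousAlternatingMap.compContinuousLinearMap_apply,
    extDeriv_conformalForm hL hw]
  simp [h]

theorem conformalTorsion_quatJ {w : Quat} (hw : w ≠ 0) :
    conformalTorsion isQuatComplexStructure_quatJ w =
      conformalTorsion isQuatComplexStructure_quatI w := by
  ext u
  rw [conformalTorsion_apply _ hw, conformalTorsion_apply _ hw]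
  congr 1
  simp only [quat_inner, quatI_apply, quatJ_apply]
  simp
  ring

theorem conformalTorsion_quatK {w : Quat} (hw : w ≠ 0) :
    conformalTorsion isQuatComplexStructure_quatK w =
      conformalTorsion isQuatComplexStructure_quatI w := by
  ext u
  rw [conformalTorsion_apply _ hw, conformalTorsion_apply _ hw]
  congr 1
  simp only [quat_inner, quatI_apply, quatK_apply]
  simp
  ring

/-- The vector `m` such that the value at `w` of the torsion form on the vectors `u` is
`-2 ⟪w, m⟫ / ‖w‖ ^ 4`. -/
def torsionVector (L : Quat →L[ℝ] Quat) (u : Fin 3 → Quat) : Quat :=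
  (inner ℝ (L (u 1)) (u 2) : ℝ) • L (u 0) - (inner ℝ (L (u 0)) (u 2) : ℝ) • L (u 1)
    + (inner ℝ (L (u 0)) (u 1) : ℝ) • L (u 2)

theorem conformalTorsion_eq {w : Quat} (hw : w ≠ 0) (u : Fin 3 → Quat) :
    conformalTorsion hL w u = -2 * ((inner ℝ w w)⁻¹) ^ 2 * inner ℝ w (torsionVector L u) := by
  rw [conformalTorsion_apply hL hw, torsionVector, inner_add_right, inner_sub_right,
    inner_smul_right, inner_smul_right, inner_smul_right]
  ring

theorem conformalTorsion_eventuallyEq {w : Quat} (hw : w ≠ 0) (u : Fin 3 → Quat) :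
    (fun z => conformalTorsion hL z u) =ᶠ[𝓝 w]
      fun z => -2 * ((inner ℝ z z)⁻¹) ^ 2 * inner ℝ z (torsionVector L u) := by
  filter_upwards [isOpen_ne.mem_nhds hw] with z hz using conformalTorsion_eq hL hz u

theorem conformalTorsion_differentiableAt {w : Quat} (hw : w ≠ 0) :
    DifferentiableAt ℝ (conformalTorsion hL) w := by
  refine differentiableAt_continuousAlternatingMap fun u => ?_
  have h : (inner ℝ w w : ℝ) ≠ 0 := by simpa using hw
  refine ContDiffAt.congr_of_eventuallyEq ?_ (conformalTorsion_eventuallyEq hL hw u)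
  exact ((contDiffAt_const.mul (((contDiffAt_id.inner ℝ contDiffAt_id).inv h).pow 2)).mul
    (contDiffAt_id.inner ℝ contDiffAt_const))

theorem fderiv_conformalTorsion {w : Quat} (hw : w ≠ 0) (u : Fin 3 → Quat) (d : Quat) :
    fderiv ℝ (fun z => conformalTorsion hL z u) w d =
      8 * ((inner ℝ w w)⁻¹) ^ 3 * inner ℝ w d * inner ℝ w (torsionVector L u)
        - 2 * ((inner ℝ w w)⁻¹) ^ 2 * inner ℝ d (torsionVector L u) := by
  have h : (inner ℝ w w : ℝ) ≠ 0 := by simpa using hw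
  have h1 : HasFDerivAt (fun z : Quat => inner ℝ z z) _ w :=
    (hasFDerivAt_id w).inner ℝ (hasFDerivAt_id w)
  have h2 : HasFDerivAt (fun z : Quat => inner ℝ z (torsionVector L u)) _ w :=
    (hasFDerivAt_id w).inner ℝ (hasFDerivAt_const (torsionVector L u) w)
  have h0 : HasDerivAt (fun t : ℝ => -2 * (t⁻¹) ^ 2) _ (inner ℝ w w) :=
    ((hasDerivAt_inv h).pow 2).const_mul (-2)
  have h3 := ((h0.comp_hasFDerivAt (f := fun z : Quat => inner ℝ z z) w h1).mul h2)
  rw [(conformalTorsion_eventuallyEq hL hw u).fderiv_eq]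
  have h4 : fderiv ℝ (fun z : Quat => -2 * ((inner ℝ z z)⁻¹) ^ 2 *
    inner ℝ z (torsionVector L u)) w = _ := h3.fderiv
  rw [h4]
  simp [real_inner_comm w d]
  ring

/-- The torsion form of the conformally flat structure is closed. A `4`-form on a space of
dimension `4` vanishes as soon as it does on a basis. -/
theorem extDeriv_conformalTorsion {w : Quat} (hw : w ≠ 0) :
    extDeriv (conformalTorsion isQuatComplexStructure_quatI) w = 0 := by
  have h : (inner ℝ w w : ℝ) ≠ 0 := by simpa using hw
  let b := (EuclideanSpace.basisFun (Fin 4) ℝ).toBasis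
  have hb : extDeriv (conformalTorsion isQuatComplexStructure_quatI) w b = 0 := by
    rw [extDeriv_apply (conformalTorsion_differentiableAt _ hw)]
    refine (Fin.sum_univ_four _).trans ?_
    simp only [fderiv_conformalTorsion _ hw]
    field_simp
    simp only [quat_inner, torsionVector, quatI_apply]
    simp [b, Fin.removeNth, Fin.succAbove]
    ring
  ext v
  have h1 := AlternatingMap.eq_smul_basis_det b
    (extDeriv (conformalTorsion isQuatComplexStructure_quatI) w).toAlternatingMap
  have h2 := congrArg (fun f => f v) h1
  refine h2.trans ?_
  change extDeriv (conformalTorsion isQuatComplexStructure_quatI) w b * _ = 0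
  rw [hb, zero_mul]

end Quaternions

/-! ### Vector fields along maps into products and vector spaces -/

section Along

variable {E : Type*} [NormedAddCommGroup E] [NormedSpace ℝ E]
  {H : Type*} [TopologicalSpace H] {IM : ModelWithCorners ℝ E H}
  {M : Type*} [TopologicalSpace M] [ChartedSpace H M]
  {E' : Type*} [NormedAddCommGroup E'] [NormedSpace ℝ E']
  {H' : Type*} [TopologicalSpace H'] {IM' : ModelWithCorners ℝ E' H'}
  {M' : Type*} [TopologicalSpace M'] [ChartedSpace H' M']
  {EX : Type*} [NormedAddCommGroup EX] [NormedSpace ℝ EX]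
  {HX : Type*} [TopologicalSpace HX] {IX : ModelWithCorners ℝ EX HX}
  {X : Type*} [TopologicalSpace X] [ChartedSpace HX X]
  {V : Type*} [NormedAddCommGroup V] [NormedSpace ℝ V]

theorem tangentBundle_mk_congr {p q : M} (h : p = q) {u : TangentSpace IM p} {v : TangentSpace IM q}
    (huv : (u : E) = v) : (⟨p, u⟩ : TangentBundle IM M) = ⟨q, v⟩ := by
  subst h
  exact congrArg _ huv

theorem contMDiffAt_tangent_normedSpace {b v : X → V} {x : X} :
    ContMDiffAt IX 𝓘(ℝ, V).tangent ∞ (fun y => (⟨b y, v y⟩ : TangentBundle 𝓘(ℝ, V) V)) x ↔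
      ContMDiffAt IX 𝓘(ℝ, V) ∞ b x ∧ ContMDiffAt IX 𝓘(ℝ, V) ∞ v x := by
  refine Bundle.contMDiffAt_totalSpace.trans ?_
  have : ∀ y, (trivializationAt V (fun z : V => TangentSpace 𝓘(ℝ, V) z) (b x)
      (⟨b y, v y⟩ : TangentBundle 𝓘(ℝ, V) V)).2 = v y := fun y => by
    simp
  simp only [this]

variable [IsManifold IM ∞ M] [IsManifold IM' ∞ M']

theorem contMDiffAt_tangent_prod {f : X → M} {h : X → M'} {a : (y : X) → TangentSpace IM (f y)}
    {b : (y : X) → TangentSpace IM' (h y)} {x : X}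
    (ha : ContMDiffAt IX IM.tangent ∞ (fun y => (⟨f y, a y⟩ : TangentBundle IM M)) x)
    (hb : ContMDiffAt IX IM'.tangent ∞ (fun y => (⟨h y, b y⟩ : TangentBundle IM' M')) x) :
    ContMDiffAt IX (IM.prod IM').tangent ∞
      (fun y => (⟨(f y, h y), (a y, b y)⟩ : TangentBundle (IM.prod IM') (M × M'))) x :=
  (contMDiff_equivTangentBundleProd_symm (I := IM) (I' := IM') (n := ∞)).contMDiffAt.comp x
    (ha.prodMk hb)

end Along

/-! ### Manifolds locally modelled on the product with the quaternions -/

section Glue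

variable {E : Type*} [NormedAddCommGroup E] [NormedSpace ℝ E]
  {H : Type*} [TopologicalSpace H] {IM : ModelWithCorners ℝ E H}
  {N : Type*} [TopologicalSpace N] [ChartedSpace H N]
  {EX : Type*} [NormedAddCommGroup EX] [NormedSpace ℝ EX]
  {HX : Type*} [TopologicalSpace HX] {IX : ModelWithCorners ℝ EX HX}
  {X : Type*} [TopologicalSpace X] [ChartedSpace HX X]

/-- The differential of the first component of a map to `N × Quat`, on the model spaces. -/
def baseDeriv (IX : ModelWithCorners ℝ EX HX) (IM : ModelWithCorners ℝ E H)
    (P : X → N × Quat) (y : X) : EX →L[ℝ] E :=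
  mfderiv IX IM (fun z => (P z).1) y

/-- The differential of the second component of a map to `N × Quat`, on the model spaces. -/
def quatDeriv (IX : ModelWithCorners ℝ EX HX) (P : X → N × Quat) (y : X) : EX →L[ℝ] Quat :=
  mfderiv IX 𝓘(ℝ, Quat) (fun z => (P z).2) y

/-- The differential of a map to `N × Quat`, on the model spaces. -/
def modelDeriv (IX : ModelWithCorners ℝ EX HX) (IM : ModelWithCorners ℝ E H)
    (P : X → N × Quat) (y : X) : EX →L[ℝ] E × Quat :=
  (baseDeriv IX IM P y).prod (quatDeriv IX P y)

/-- The endomorphism `A × L` of the tangent space of `N × Quat`. -/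
def modelEnd (A : EndField IM N) (L : Quat →L[ℝ] Quat) (p : N) : E × Quat →L[ℝ] E × Quat :=
  ContinuousLinearMap.prodMap (A p : E →L[ℝ] E) L

variable [IsManifold IM ∞ N]

/-- Smooth maps preserving the metric and the three complex structures. -/
structure HyperhermitianStructure.Preserves (s : HyperhermitianStructure IM N) (f : N → N) :
    Prop where
  smooth : ContMDiff IM IM ∞ f
  metric : ∀ (x : N) (v w : TangentSpace IM x),
    s.g.inner (f x) (mfderiv IM IM f x v) (mfderiv IM IM f x w) = s.g.inner x v w
  map_I : ∀ (x : N) (v : TangentSpace IM x),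
    mfderiv IM IM f x (s.I x v) = s.I (f x) (mfderiv IM IM f x v)
  map_J : ∀ (x : N) (v : TangentSpace IM x),
    mfderiv IM IM f x (s.J x v) = s.J (f x) (mfderiv IM IM f x v)
  map_K : ∀ (x : N) (v : TangentSpace IM x),
    mfderiv IM IM f x (s.K x v) = s.K (f x) (mfderiv IM IM f x v)

theorem HyperhermitianStructure.Preserves.mfderiv_injective {s : HyperhermitianStructure IM N}
    {f : N → N} (hf : s.Preserves f) (x : N) : Function.Injective (mfderiv IM IM f x) := by
  refine (injective_iff_map_eq_zero _).2 fun v hv => ?_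
  by_contra h
  have h1 := s.g.pos x v h
  rw [← hf.metric x v v, hv] at h1
  simp at h1

/-- A family of local diffeomorphisms `P x`, defined near `x`, from `X` to `N × (Quat \ {0})` whose
transition maps locally are products of maps preserving the structure of `N` and of homotheties. -/
structure IsModelAtlas (IX : ModelWithCorners ℝ EX HX) (s : HyperhermitianStructure IM N)
    (P : X → OpenPartialHomeomorph X (N × Quat)) : Prop where
  mem : ∀ x, x ∈ (P x).source
  ne_zero : ∀ x, ∀ y ∈ (P x).source, (P x y).2 ≠ 0
  smooth : ∀ x, ContMDiffOn IX (IM.prod 𝓘(ℝ, Quat)) ∞ (P x) (P x).source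
  smooth_symm : ∀ x, ContMDiffOn (IM.prod 𝓘(ℝ, Quat)) IX ∞ (P x).symm (P x).target
  compat : ∀ x, ∀ y ∈ (P x).source, ∃ (f : N → N) (c : ℝ), s.Preserves f ∧ c ≠ 0 ∧
    ∀ᶠ z in 𝓝 y, P y z = (f (P x z).1, c • (P x z).2)

/-- The product of the metric of `N` and of the conformally flat metric `⟪·, ·⟫ / ‖w‖²`. -/
def modelInner (g : SmoothMetric IM N) (p : N × Quat) : E × Quat →L[ℝ] E × Quat →L[ℝ] ℝ :=
  let G : E →L[ℝ] E →L[ℝ] ℝ := g.inner p.1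
  let G' : Quat →L[ℝ] Quat →L[ℝ] ℝ := innerSL ℝ
  G.bilinearComp (ContinuousLinearMap.fst ℝ E Quat) (ContinuousLinearMap.fst ℝ E Quat) +
    (inner ℝ p.2 p.2 : ℝ)⁻¹ • G'.bilinearComp
      (ContinuousLinearMap.snd ℝ E Quat) (ContinuousLinearMap.snd ℝ E Quat)

/-- The endomorphism field of `X` given at `x` by `A × L` in the local model `P x`. The map
`ContinuousLinearMap.inverse` is a genuine inverse here, see `IsModelAtlas.inverse_modelDeriv`. -/
def gluedEnd (IX : ModelWithCorners ℝ EX HX) (P : X → OpenPartialHomeomorph X (N × Quat))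
    (A : EndField IM N) (L : Quat →L[ℝ] Quat) : EndField IX X := fun x =>
  ((modelDeriv IX IM (P x) x).inverse.comp
    ((modelEnd A L (P x x).1).comp (modelDeriv IX IM (P x) x)) : EX →L[ℝ] EX)

/-- The bilinear forms on `X` given at `x` by the product metric in the local model `P x`. -/
def gluedInner (IX : ModelWithCorners ℝ EX HX) (P : X → OpenPartialHomeomorph X (N × Quat))
    (g : SmoothMetric IM N) (x : X) : EX →L[ℝ] EX →L[ℝ] ℝ :=
  (modelInner g (P x x)).bilinearComp (modelDeriv IX IM (P x) x) (modelDeriv IX IM (P x) x)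

theorem modelInner_apply (g : SmoothMetric IM N) (p : N × Quat) (v w : E × Quat) :
    modelInner g p v w = (g.inner p.1 : E →L[ℝ] E →L[ℝ] ℝ) v.1 w.1 +
      (inner ℝ p.2 p.2 : ℝ)⁻¹ * inner ℝ v.2 w.2 := rfl

namespace IsModelAtlas

variable {s : HyperhermitianStructure IM N} {P : X → OpenPartialHomeomorph X (N × Quat)}
  (hP : IsModelAtlas IX s P) {x y : X} (hy : y ∈ (P x).source)

include hP hy

theorem smoothAt : ContMDiffAt IX (IM.prod 𝓘(ℝ, Quat)) ∞ (P x) y :=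
  (hP.smooth x).contMDiffAt ((P x).open_source.mem_nhds hy)

theorem smoothAt_symm : ContMDiffAt (IM.prod 𝓘(ℝ, Quat)) IX ∞ (P x).symm (P x y) :=
  (hP.smooth_symm x).contMDiffAt ((P x).open_target.mem_nhds ((P x).map_source hy))

theorem smoothAt_fst : ContMDiffAt IX IM ∞ (fun z => (P x z).1) y :=
  contMDiffAt_fst.comp y (hP.smoothAt hy)

theorem smoothAt_snd : ContMDiffAt IX 𝓘(ℝ, Quat) ∞ (fun z => (P x z).2) y :=
  contMDiffAt_snd.comp y (hP.smoothAt hy)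

theorem modelDeriv_eq : modelDeriv IX IM (P x) y =
    (mfderiv IX (IM.prod 𝓘(ℝ, Quat)) (P x) y : EX →L[ℝ] E × Quat) := by
  have h1 := (hP.smoothAt_fst hy).mdifferentiableAt (by simp)
  have h2 := (hP.smoothAt_snd hy).mdifferentiableAt (by simp)
  exact (mfderiv_prodMk h1 h2).symm

theorem symm_comp_modelDeriv (v : EX) :
    (mfderiv (IM.prod 𝓘(ℝ, Quat)) IX (P x).symm (P x y) : E × Quat →L[ℝ] EX)
      (modelDeriv IX IM (P x) y v) = v := by
  rw [hP.modelDeriv_eq hy]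
  have hm : (P x).MDifferentiable IX (IM.prod 𝓘(ℝ, Quat)) :=
    ⟨(hP.smooth x).mdifferentiableOn (by simp), (hP.smooth_symm x).mdifferentiableOn (by simp)⟩
  exact congrArg (fun T : EX →L[ℝ] EX => T v) (hm.symm_comp_deriv hy)

theorem modelDeriv_comp_symm (v : E × Quat) :
    modelDeriv IX IM (P x) y
      ((mfderiv (IM.prod 𝓘(ℝ, Quat)) IX (P x).symm (P x y) : E × Quat →L[ℝ] EX) v) = v := by
  rw [hP.modelDeriv_eq hy]
  have hm : (P x).MDifferentiable IX (IM.prod 𝓘(ℝ, Quat)) :=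
    ⟨(hP.smooth x).mdifferentiableOn (by simp), (hP.smooth_symm x).mdifferentiableOn (by simp)⟩
  have h := hm.comp_symm_deriv ((P x).map_source hy)
  rw [(P x).left_inv hy] at h
  exact congrArg (fun T : E × Quat →L[ℝ] E × Quat => T v) h

theorem modelDeriv_injective : Function.Injective (modelDeriv IX IM (P x) y) :=
  Function.LeftInverse.injective (hP.symm_comp_modelDeriv hy)

theorem inverse_modelDeriv : (modelDeriv IX IM (P x) y).inverse =
    (mfderiv (IM.prod 𝓘(ℝ, Quat)) IX (P x).symm (P x y) : E × Quat →L[ℝ] EX) := by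
  refine ContinuousLinearMap.inverse_eq ?_ ?_
  · exact ContinuousLinearMap.ext fun v => hP.modelDeriv_comp_symm hy v
  · exact ContinuousLinearMap.ext fun v => hP.symm_comp_modelDeriv hy v

/-- The change of local models multiplies the second component of the differential by a constant,
and composes the first one with the differential of a map preserving the structure of `N`. -/
theorem exists_transition : ∃ (f : N → N) (c : ℝ), s.Preserves f ∧ c ≠ 0 ∧
    P y y = (f (P x y).1, c • (P x y).2) ∧
    (∀ v, baseDeriv IX IM (P y) y v =
      (mfderiv IM IM f (P x y).1 : E →L[ℝ] E) (baseDeriv IX IM (P x) y v)) ∧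
    (∀ v, quatDeriv IX (P y) y v = c • quatDeriv IX (P x) y v) := by
  obtain ⟨f, c, hf, hc, h⟩ := hP.compat x y hy
  refine ⟨f, c, hf, hc, h.self_of_nhds, fun v => ?_, fun v => ?_⟩
  · have h1 : (fun z => (P y z).1) =ᶠ[𝓝 y] fun z => f (P x z).1 := by
      filter_upwards [h] with z hz
      rw [hz]
    have h2 := mfderiv_comp y (hf.smooth.mdifferentiable (by simp) _)
      ((hP.smoothAt_fst hy).mdifferentiableAt (by simp))
    have h3 := (h1.mfderiv_eq (I := IX) (I' := IM)).trans h2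
    exact congrArg (fun T : EX →L[ℝ] E => T v) h3
  · have h1 : (fun z => (P y z).2) =ᶠ[𝓝 y] fun z => c • (P x z).2 := by
      filter_upwards [h] with z hz
      rw [hz]
    let C : Quat →L[ℝ] Quat := c • ContinuousLinearMap.id ℝ Quat
    have h2 := mfderiv_comp y (C.contMDiff.mdifferentiable (n := ∞) (by simp) (P x y).2)
      ((hP.smoothAt_snd hy).mdifferentiableAt (by simp))
    have h3 := (h1.mfderiv_eq (I := IX) (I' := 𝓘(ℝ, Quat))).trans h2
    have h4 : (mfderiv 𝓘(ℝ, Quat) 𝓘(ℝ, Quat) C (P x y).2 : Quat →L[ℝ] Quat) = C :=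
      C.mfderiv_eq
    have h5 := congrArg (fun T : EX →L[ℝ] Quat => T v) h3
    exact h5.trans (congrArg (fun T : Quat →L[ℝ] Quat => T (quatDeriv IX (P x) y v)) h4)

/-- The glued endomorphism field is `A × L` in each local model, not only in the one centred at the
point considered, as used in its definition: `A × L` commutes with the transition maps. -/
theorem modelDeriv_gluedEnd {A : EndField IM N}
    (hA : ∀ f, s.Preserves f → ∀ (x : N) (v : TangentSpace IM x),
      mfderiv IM IM f x (A x v) = A (f x) (mfderiv IM IM f x v))
    (L : Quat →L[ℝ] Quat) (v : EX) :
    modelDeriv IX IM (P x) y ((gluedEnd IX P A L y : EX →L[ℝ] EX) v) =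
      modelEnd A L (P x y).1 (modelDeriv IX IM (P x) y v) := by
  obtain ⟨f, c, hf, hc, h0, h1, h2⟩ := hP.exists_transition hy
  set u : EX := (gluedEnd IX P A L y : EX →L[ℝ] EX) v with hu
  have h3 : modelDeriv IX IM (P y) y u =
      modelEnd A L (P y y).1 (modelDeriv IX IM (P y) y v) := by
    have := hP.modelDeriv_comp_symm (hP.mem y)
      (modelEnd A L (P y y).1 (modelDeriv IX IM (P y) y v))
    rwa [← hP.inverse_modelDeriv (hP.mem y)] at this
  have h4 : baseDeriv IX IM (P y) y u =
      (A (P y y).1 : E →L[ℝ] E) (baseDeriv IX IM (P y) y v) := congrArg Prod.fst h3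
  have h5 : quatDeriv IX (P y) y u = L (quatDeriv IX (P y) y v) := congrArg Prod.snd h3
  rw [h2, h2, map_smul] at h5
  rw [h1, h1, h0] at h4
  refine Prod.ext ?_ (smul_right_injective _ hc h5)
  refine hf.mfderiv_injective _ (h4.trans ?_)
  exact (hA f hf (P x y).1 (baseDeriv IX IM (P x) y v)).symm

/-- The glued metric is the product metric in each local model: the product metric is invariant
under the transition maps. -/
theorem gluedInner_apply (v w : EX) :
    gluedInner IX P s.g y v w =
      modelInner s.g (P x y) (modelDeriv IX IM (P x) y v) (modelDeriv IX IM (P x) y w) := by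
  obtain ⟨f, c, hf, hc, h0, h1, h2⟩ := hP.exists_transition hy
  have h3 := hf.metric (P x y).1 (baseDeriv IX IM (P x) y v) (baseDeriv IX IM (P x) y w)
  change modelInner s.g (P y y) (modelDeriv IX IM (P y) y v) (modelDeriv IX IM (P y) y w) = _
  rw [modelInner_apply, modelInner_apply, h0]
  change (s.g.inner (f (P x y).1) : E →L[ℝ] E →L[ℝ] ℝ) (baseDeriv IX IM (P y) y v)
    (baseDeriv IX IM (P y) y w) + (inner ℝ (c • (P x y).2) (c • (P x y).2) : ℝ)⁻¹ *
      inner ℝ (quatDeriv IX (P y) y v) (quatDeriv IX (P y) y w) = _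
  rw [h1, h1, h2, h2]
  refine congrArg₂ (· + ·) h3 ?_
  simp only [inner_smul_left, inner_smul_right, conj_trivial]
  change _ = (inner ℝ (P x y).2 (P x y).2 : ℝ)⁻¹ *
    inner ℝ (quatDeriv IX (P x) y v) (quatDeriv IX (P x) y w)
  field_simp

end IsModelAtlas

end Glue

/-! ### The glued metric and its torsion -/

section Glued

variable {E : Type*} [NormedAddCommGroup E] [NormedSpace ℝ E]
  {H : Type*} [TopologicalSpace H] {IM : ModelWithCorners ℝ E H}
  {N : Type*} [TopologicalSpace N] [ChartedSpace H N] [IsManifold IM ∞ N]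
  {EX : Type*} [NormedAddCommGroup EX] [NormedSpace ℝ EX]
  {HX : Type*} [TopologicalSpace HX] {IX : ModelWithCorners ℝ EX HX}
  {X : Type*} [TopologicalSpace X] [ChartedSpace HX X]
  {s : HyperhermitianStructure IM N} {P : X → OpenPartialHomeomorph X (N × Quat)}

/-- Endomorphism fields of `N` invariant under all maps preserving the structure of `N`. -/
def HyperhermitianStructure.IsInvariant (s : HyperhermitianStructure IM N) (A : EndField IM N) :
    Prop :=
  ∀ f, s.Preserves f → ∀ (x : N) (v : TangentSpace IM x),
    mfderiv IM IM f x (A x v) = A (f x) (mfderiv IM IM f x v)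

theorem metric_inner_self_nonneg (g : SmoothMetric IM N) (p : N) (v : E) :
    0 ≤ (g.inner p : E →L[ℝ] E →L[ℝ] ℝ) v v := by
  by_cases h : v = 0
  · subst h
    exact (map_zero ((g.inner p : E →L[ℝ] E →L[ℝ] ℝ) 0)).ge
  · exact (g.pos p v h).le

theorem contMDiffAt_inner {f h : X → Quat} {x : X} (hf : ContMDiffAt IX 𝓘(ℝ, Quat) ∞ f x)
    (hh : ContMDiffAt IX 𝓘(ℝ, Quat) ∞ h x) :
    ContMDiffAt IX 𝓘(ℝ, ℝ) ∞ (fun y => (inner ℝ (f y) (h y) : ℝ)) x :=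
  ((contDiff_inner (𝕜 := ℝ) (E := Quat) (n := ∞)).contMDiff.contMDiffAt (x := (f x, h x))).comp x
    (hf.prodMk_space hh)

namespace IsModelAtlas

variable (hP : IsModelAtlas IX s P)

include hP

theorem gluedEnd_ext {x : X} {v w : EX}
    (h1 : baseDeriv IX IM (P x) x v = baseDeriv IX IM (P x) x w)
    (h2 : quatDeriv IX (P x) x v = quatDeriv IX (P x) x w) : v = w :=
  hP.modelDeriv_injective (hP.mem x) (Prod.ext h1 h2)

theorem baseDeriv_gluedEnd {x y : X} (hy : y ∈ (P x).source) {A : EndField IM N}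
    (hinv : s.IsInvariant A) (L : Quat →L[ℝ] Quat) (v : EX) :
    baseDeriv IX IM (P x) y ((gluedEnd IX P A L y : EX →L[ℝ] EX) v) =
      (A (P x y).1 : E →L[ℝ] E) (baseDeriv IX IM (P x) y v) :=
  congrArg Prod.fst (hP.modelDeriv_gluedEnd hy hinv L v)

theorem quatDeriv_gluedEnd {x y : X} (hy : y ∈ (P x).source) {A : EndField IM N}
    (hinv : s.IsInvariant A) (L : Quat →L[ℝ] Quat) (v : EX) :
    quatDeriv IX (P x) y ((gluedEnd IX P A L y : EX →L[ℝ] EX) v) =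
      L (quatDeriv IX (P x) y v) :=
  congrArg Prod.snd (hP.modelDeriv_gluedEnd hy hinv L v)

theorem gluedInner_eq {x y : X} (hy : y ∈ (P x).source) (v w : EX) :
    gluedInner IX P s.g y v w = (s.g.inner (P x y).1 : E →L[ℝ] E →L[ℝ] ℝ)
      (baseDeriv IX IM (P x) y v) (baseDeriv IX IM (P x) y w) +
        (inner ℝ (P x y).2 (P x y).2 : ℝ)⁻¹ *
          inner ℝ (quatDeriv IX (P x) y v) (quatDeriv IX (P x) y w) :=
  hP.gluedInner_apply hy v w

theorem gluedInner_symm (x : X) (v w : EX) :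
    gluedInner IX P s.g x v w = gluedInner IX P s.g x w v := by
  refine (hP.gluedInner_eq (hP.mem x) v w).trans
    (Eq.trans ?_ (hP.gluedInner_eq (hP.mem x) w v).symm)
  rw [real_inner_comm (quatDeriv IX (P x) x v)]
  exact congrArg₂ (· + ·) (s.g.symm (P x x).1 _ _) rfl

theorem gluedInner_pos (x : X) (v : EX) (hv : v ≠ 0) : 0 < gluedInner IX P s.g x v v := by
  rw [hP.gluedInner_eq (hP.mem x) v v]
  have h0 : (0 : ℝ) < inner ℝ (P x x).2 (P x x).2 :=
    real_inner_self_pos.2 (hP.ne_zero x x (hP.mem x))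
  have h1 := metric_inner_self_nonneg s.g (P x x).1 (baseDeriv IX IM (P x) x v)
  by_cases h : quatDeriv IX (P x) x v = 0
  · have h2 : baseDeriv IX IM (P x) x v ≠ 0 := fun h2 =>
      hv (hP.gluedEnd_ext (by rw [h2, map_zero]) (by rw [h, map_zero]))
    rw [h, inner_zero_left, mul_zero, add_zero]
    exact s.g.pos (P x x).1 _ h2
  · have h3 : (0 : ℝ) < inner ℝ (quatDeriv IX (P x) x v) (quatDeriv IX (P x) x v) :=
      real_inner_self_pos.2 h
    positivity

theorem isBounded_gluedInner_lt_one (x : X) :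
    Bornology.IsBounded {v : EX | gluedInner IX P s.g x v v < 1} := by
  have hb : Bornology.IsBounded {u : E | (s.g.inner (P x x).1 : E →L[ℝ] E →L[ℝ] ℝ) u u < 1} :=
    NormedSpace.isVonNBounded_iff ℝ |>.1 (s.g.isVonNBounded (P x x).1)
  obtain ⟨R, hR⟩ := hb.exists_norm_le
  set c : ℝ := inner ℝ (P x x).2 (P x x).2 with hc
  have h0 : 0 < c := real_inner_self_pos.2 (hP.ne_zero x x (hP.mem x))
  let T : E × Quat →L[ℝ] EX := mfderiv (IM.prod 𝓘(ℝ, Quat)) IX (P x).symm (P x x)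
  refine isBounded_iff_forall_norm_le.2 ⟨‖T‖ * max R (c + 1), fun v hv => ?_⟩
  have h1 := metric_inner_self_nonneg s.g (P x x).1 (baseDeriv IX IM (P x) x v)
  have h2 : 0 ≤ c⁻¹ * inner ℝ (quatDeriv IX (P x) x v) (quatDeriv IX (P x) x v) :=
    mul_nonneg (inv_nonneg.2 h0.le) real_inner_self_nonneg
  have hv' := (hP.gluedInner_eq (hP.mem x) v v).symm.trans_lt hv
  have h3 : ‖baseDeriv IX IM (P x) x v‖ ≤ R := hR _ (by
    change (s.g.inner (P x x).1 : E →L[ℝ] E →L[ℝ] ℝ) _ _ < 1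
    linarith)
  -- the square of this norm is less than `c`
  have h4 : ‖quatDeriv IX (P x) x v‖ ≤ c + 1 := by
    have h5 : c⁻¹ * ‖quatDeriv IX (P x) x v‖ ^ 2 < 1 := by
      rw [← real_inner_self_eq_norm_sq]
      linarith
    rw [inv_mul_lt_iff₀ h0] at h5
    nlinarith [norm_nonneg (quatDeriv IX (P x) x v)]
  calc ‖v‖ = ‖T (modelDeriv IX IM (P x) x v)‖ :=
      congrArg norm (hP.symm_comp_modelDeriv (hP.mem x) v).symm
    _ ≤ ‖T‖ * ‖modelDeriv IX IM (P x) x v‖ := T.le_opNorm _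
    _ ≤ ‖T‖ * max R (c + 1) := by
      gcongr
      exact max_le_max h3 h4

theorem gluedInner_gluedEnd {x y : X} (hy : y ∈ (P x).source) {A : EndField IM N}
    (hinv : s.IsInvariant A) (L : Quat →L[ℝ] Quat) (v w : EX) :
    gluedInner IX P s.g y ((gluedEnd IX P A L y : EX →L[ℝ] EX) v) w =
      (s.g.inner (P x y).1 : E →L[ℝ] E →L[ℝ] ℝ)
        ((A (P x y).1 : E →L[ℝ] E) (baseDeriv IX IM (P x) y v)) (baseDeriv IX IM (P x) y w) +
      (inner ℝ (P x y).2 (P x y).2 : ℝ)⁻¹ *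
        inner ℝ (L (quatDeriv IX (P x) y v)) (quatDeriv IX (P x) y w) :=
  (hP.gluedInner_eq hy _ w).trans (congrArg₂ (fun (a : E) (b : Quat) =>
    (s.g.inner (P x y).1 : E →L[ℝ] E →L[ℝ] ℝ) a (baseDeriv IX IM (P x) y w) +
      (inner ℝ (P x y).2 (P x y).2 : ℝ)⁻¹ * inner ℝ b (quatDeriv IX (P x) y w))
    (hP.baseDeriv_gluedEnd hy hinv L v) (hP.quatDeriv_gluedEnd hy hinv L v))

theorem gluedInner_gluedEnd_skew {A : EndField IM N} (hskew : s.g.IsSkew A)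
    (hinv : s.IsInvariant A) {L : Quat →L[ℝ] Quat} (hL : IsQuatComplexStructure L) (x : X)
    (v w : EX) :
    gluedInner IX P s.g x ((gluedEnd IX P A L x : EX →L[ℝ] EX) v) w =
      -gluedInner IX P s.g x v ((gluedEnd IX P A L x : EX →L[ℝ] EX) w) := by
  refine (hP.gluedInner_gluedEnd (hP.mem x) hinv L v w).trans (Eq.trans ?_ (congrArg Neg.neg
    ((hP.gluedInner_symm x v _).trans (hP.gluedInner_gluedEnd (hP.mem x) hinv L w v))).symm)
  rw [hL.skew, real_inner_comm (L (quatDeriv IX (P x) x w))]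
  have h1 : (s.g.inner (P x x).1 : E →L[ℝ] E →L[ℝ] ℝ)
      ((A (P x x).1 : E →L[ℝ] E) (baseDeriv IX IM (P x) x v)) (baseDeriv IX IM (P x) x w) =
      -(s.g.inner (P x x).1 : E →L[ℝ] E →L[ℝ] ℝ)
      ((A (P x x).1 : E →L[ℝ] E) (baseDeriv IX IM (P x) x w)) (baseDeriv IX IM (P x) x v) :=
    (hskew (P x x).1 (baseDeriv IX IM (P x) x v) (baseDeriv IX IM (P x) x w)).trans
      (congrArg Neg.neg (s.g.symm (P x x).1 _ _))
  rw [h1]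
  ring

variable [IsManifold IX ∞ X]

theorem baseDeriv_smoothAt {x : X} {v : TangentField IX X} (hv : v.SmoothAt x) :
    ContMDiffAt IX IM.tangent ∞
      (fun y => (⟨(P x y).1, baseDeriv IX IM (P x) y (v y)⟩ : TangentBundle IM N)) x :=
  contMDiffAt_mfderiv_apply (b := id) (hP.smoothAt_fst (hP.mem x)) hv

theorem quatDeriv_smoothAt {x : X} {v : TangentField IX X} (hv : v.SmoothAt x) :
    ContMDiffAt IX 𝓘(ℝ, Quat) ∞ (fun y => quatDeriv IX (P x) y (v y)) x :=
  (contMDiffAt_tangent_normedSpace.1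
    (contMDiffAt_mfderiv_apply (b := id) (hP.smoothAt_snd (hP.mem x)) hv)).2

theorem gluedInner_contMDiffAt {x : X} {v w : TangentField IX X} (hv : v.SmoothAt x)
    (hw : w.SmoothAt x) :
    ContMDiffAt IX 𝓘(ℝ, ℝ) ∞ (fun y => gluedInner IX P s.g y (v y) (w y)) x := by
  have h0 : ContMDiffAt IX 𝓘(ℝ, ℝ) ∞ (fun y => (inner ℝ (P x y).2 (P x y).2 : ℝ)⁻¹) x :=
    (contMDiffAt_inner (hP.smoothAt_snd (hP.mem x)) (hP.smoothAt_snd (hP.mem x))).inv₀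
      (by simpa using hP.ne_zero x x (hP.mem x))
  have h1 := s.g.contMDiffAt_apply (hP.baseDeriv_smoothAt hv) (hP.baseDeriv_smoothAt hw)
  have h2 := contMDiffAt_inner (hP.quatDeriv_smoothAt hv) (hP.quatDeriv_smoothAt hw)
  refine (h1.add (h0.mul h2)).congr_of_eventuallyEq ?_
  filter_upwards [(P x).open_source.mem_nhds (hP.mem x)] with y hy
  exact hP.gluedInner_eq hy (v y) (w y)

variable [FiniteDimensional ℝ EX]

theorem gluedEnd_isSmooth {A : EndField IM N} (hA : A.IsSmooth) (hinv : s.IsInvariant A)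
    (L : Quat →L[ℝ] Quat) : (gluedEnd IX P A L).IsSmooth := by
  intro x
  refine contMDiffAt_endField fun v hv => ?_
  have h1 := hA.contMDiffAt_apply (hP.baseDeriv_smoothAt hv)
  have h2 := contMDiffAt_tangent_normedSpace.2 ⟨hP.smoothAt_snd (hP.mem x),
    L.contMDiff.contMDiffAt.comp x (hP.quatDeriv_smoothAt hv)⟩
  have h3 := contMDiffAt_tangent_prod h1 h2
  have h4 := contMDiffAt_mfderiv_apply (hP.smoothAt_symm (hP.mem x)) h3
  refine h4.congr_of_eventuallyEq ?_
  filter_upwards [(P x).open_source.mem_nhds (hP.mem x)] with y hy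
  refine tangentBundle_mk_congr ((P x).left_inv hy).symm ?_
  have h5 := hP.symm_comp_modelDeriv hy ((gluedEnd IX P A L y : EX →L[ℝ] EX) (v y))
  have h6 := hP.modelDeriv_gluedEnd hy hinv L (v y)
  exact h5.symm.trans (congrArg (fun u =>
    (mfderiv (IM.prod 𝓘(ℝ, Quat)) IX (P x).symm (P x y) : E × Quat →L[ℝ] EX) u) h6)

/-- The metric `gluedInner` on `X`, as a smooth Riemannian metric. -/
def metric : SmoothMetric IX X where
  inner x :=
    let G : EX →L[ℝ] EX →L[ℝ] ℝ := gluedInner IX P s.g x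
    G
  symm x v w := hP.gluedInner_symm x v w
  pos x v hv := hP.gluedInner_pos x v hv
  isVonNBounded x :=
    (NormedSpace.isVonNBounded_iff ℝ (E := EX)).2 (hP.isBounded_gluedInner_lt_one x)
  contMDiff _ := contMDiffAt_bilinField fun _ _ hv hw => hP.gluedInner_contMDiffAt hv hw

theorem gluedEnd_isSkew {A : EndField IM N} (hskew : s.g.IsSkew A) (hinv : s.IsInvariant A)
    {L : Quat →L[ℝ] Quat} (hL : IsQuatComplexStructure L) :
    hP.metric.IsSkew (gluedEnd IX P A L) :=
  fun x v w => hP.gluedInner_gluedEnd_skew hskew hinv hL x v w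

/-- In the local models, the fundamental form is the sum of the pullbacks of the fundamental form
of `N` and of the conformally flat one. -/
theorem fundamentalForm_eq {A : EndField IM N} (hskew : s.g.IsSkew A) (hinv : s.IsInvariant A)
    {L : Quat →L[ℝ] Quat} (hL : IsQuatComplexStructure L) {x y : X} (hy : y ∈ (P x).source) :
    fundamentalForm hP.metric (gluedEnd IX P A L) (hP.gluedEnd_isSkew hskew hinv hL) y =
      ((fundamentalForm s.g A hskew).pullback IX (fun z => (P x z).1) +
        FormField.pullback (IM' := 𝓘(ℝ, Quat)) (M' := Quat) IX (fun z => (P x z).2)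
          (conformalForm hL)) y := by
  ext v
  exact hP.gluedInner_gluedEnd hy hinv L (v 0) (v 1)

variable [IM.Boundaryless] [IX.Boundaryless] [FiniteDimensional ℝ E]

/-- The hyperkähler factor does not contribute to the torsion. -/
theorem bismutTorsion_eq {A : EndField IM N} (hA : A.IsSmooth) (hskew : s.g.IsSkew A)
    (hclosed : (fundamentalForm s.g A hskew).extDer = 0) (hinv : s.IsInvariant A)
    {L : Quat →L[ℝ] Quat} (hL : IsQuatComplexStructure L) {x y : X} (hy : y ∈ (P x).source) :
    bismutTorsion hP.metric (gluedEnd IX P A L) (hP.gluedEnd_isSkew hskew hinv hL) y =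
      FormField.pullback (IM' := 𝓘(ℝ, Quat)) (M' := Quat) IX (fun z => (P x z).2)
          (conformalTorsion hL) y := by
  have hsrc := (P x).open_source.mem_nhds hy
  have h1 := FormField.extDer_congr (Filter.eventually_of_mem hsrc
    fun z hz => hP.fundamentalForm_eq hskew hinv hL hz)
  have hd := fundamentalForm_diffAt s.g hA hskew (P x y).1
  have hd' : FormField.DiffAt (IM := 𝓘(ℝ, Quat)) (M := Quat) (conformalForm hL) (P x y).2 :=
    FormField.diffAt_normedSpace.2 (conformalForm_differentiableAt hL (hP.ne_zero x y hy))
  rw [FormField.extDer_add (hd.pullback (hP.smoothAt_fst hy)) (hd'.pullback (hP.smoothAt_snd hy)),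
    FormField.extDer_pullback (hP.smoothAt_fst hy) hd,
    FormField.extDer_pullback (hP.smoothAt_snd hy) hd', hclosed] at h1
  ext v
  have h2 := congrArg (fun a => a fun i => gluedEnd IX P A L y (v i)) h1
  refine h2.trans ?_
  have h3 : (FormField.extDer (IM := 𝓘(ℝ, Quat)) (M := Quat) (conformalForm hL)) (P x y).2 =
      extDeriv (conformalForm hL) (P x y).2 := FormField.extDer_normedSpace _ _
  have h4 : (fun i => quatDeriv IX (P x) y ((gluedEnd IX P A L y : EX →L[ℝ] EX) (v i))) =
      fun i => L (quatDeriv IX (P x) y (v i)) :=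
    funext fun i => hP.quatDeriv_gluedEnd hy hinv L (v i)
  refine (zero_add _).trans ?_
  exact (congrArg (fun u => (FormField.extDer (IM := 𝓘(ℝ, Quat)) (M := Quat) (conformalForm hL))
    (P x y).2 u) h4).trans (congrArg (fun b : Quat [⋀^Fin 3]→L[ℝ] ℝ =>
      b fun i => L (quatDeriv IX (P x) y (v i))) h3)

theorem extDer_bismutTorsion_eq_zero {A : EndField IM N} (hA : A.IsSmooth) (hskew : s.g.IsSkew A)
    (hclosed : (fundamentalForm s.g A hskew).extDer = 0) (hinv : s.IsInvariant A)
    {L : Quat →L[ℝ] Quat} (hL : IsQuatComplexStructure L)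
    (hL' : ∀ w, w ≠ 0 → conformalTorsion hL w = conformalTorsion isQuatComplexStructure_quatI w) :
    (bismutTorsion hP.metric (gluedEnd IX P A L) (hP.gluedEnd_isSkew hskew hinv hL)).extDer =
      0 := by
  funext x
  have hsrc := (P x).open_source.mem_nhds (hP.mem x)
  have hx := hP.ne_zero x x (hP.mem x)
  have h1 := FormField.extDer_congr (Filter.eventually_of_mem hsrc
    fun z hz => hP.bismutTorsion_eq hA hskew hclosed hinv hL hz)
  have hd : FormField.DiffAt (IM := 𝓘(ℝ, Quat)) (M := Quat) (conformalTorsion hL) (P x x).2 :=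
    FormField.diffAt_normedSpace.2 (conformalTorsion_differentiableAt hL hx)
  have h2 : conformalTorsion hL =ᶠ[𝓝 (P x x).2]
      conformalTorsion isQuatComplexStructure_quatI := by
    filter_upwards [isOpen_ne.mem_nhds hx] with w hw using hL' w hw
  have h3 : (FormField.extDer (IM := 𝓘(ℝ, Quat)) (M := Quat) (conformalTorsion hL)) (P x x).2 =
      0 := (FormField.extDer_normedSpace _ _).trans
        (h2.extDeriv_eq.trans (extDeriv_conformalTorsion hx))
  rw [h1, FormField.extDer_pullback (hP.smoothAt_snd (hP.mem x)) hd]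
  ext v
  exact congrArg (fun b : Quat [⋀^Fin 4]→L[ℝ] ℝ => b fun i => quatDeriv IX (P x) x (v i)) h3

end IsModelAtlas

end Glued

/-! ### The glued hyperhermitian structure -/

section GluedStructure

variable {E : Type*} [NormedAddCommGroup E] [NormedSpace ℝ E]
  {H : Type*} [TopologicalSpace H] {IM : ModelWithCorners ℝ E H}
  {N : Type*} [TopologicalSpace N] [ChartedSpace H N] [IsManifold IM ∞ N]
  {EX : Type*} [NormedAddCommGroup EX] [NormedSpace ℝ EX]
  {HX : Type*} [TopologicalSpace HX] {IX : ModelWithCorners ℝ EX HX}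
  {X : Type*} [TopologicalSpace X] [ChartedSpace HX X]
  {s : HyperhermitianStructure IM N} {P : X → OpenPartialHomeomorph X (N × Quat)}

namespace IsModelAtlas

variable (hP : IsModelAtlas IX s P)

include hP

theorem gluedEnd_gluedEnd {A B : EndField IM N} (hA : s.IsInvariant A) (hB : s.IsInvariant B)
    (L L' : Quat →L[ℝ] Quat) {x : X} {v u : EX}
    (h1 : (A (P x x).1 : E →L[ℝ] E) ((B (P x x).1 : E →L[ℝ] E) (baseDeriv IX IM (P x) x v)) =
      baseDeriv IX IM (P x) x u)
    (h2 : L (L' (quatDeriv IX (P x) x v)) = quatDeriv IX (P x) x u) :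
    (gluedEnd IX P A L x : EX →L[ℝ] EX) ((gluedEnd IX P B L' x : EX →L[ℝ] EX) v) = u := by
  refine hP.gluedEnd_ext (x := x) ?_ ?_
  · refine (hP.baseDeriv_gluedEnd (hP.mem x) hA L _).trans (Eq.trans ?_ h1)
    exact congrArg (A (P x x).1 : E →L[ℝ] E) (hP.baseDeriv_gluedEnd (hP.mem x) hB L' v)
  · refine (hP.quatDeriv_gluedEnd (hP.mem x) hA L _).trans (Eq.trans ?_ h2)
    exact congrArg L (hP.quatDeriv_gluedEnd (hP.mem x) hB L' v)

/-- The glued endomorphism fields are integrable: holomorphic coordinates are given by holomorphic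
coordinates of `N` and linear complex coordinates of the quaternions. -/
theorem exists_holomorphic_chart {A : EndField IM N} (hA : IsComplexStructure A)
    (hinv : s.IsInvariant A) {L : Quat →L[ℝ] Quat} (hL : IsQuatComplexStructure L) (x : X) :
    ∃ (k : ℕ) (φ : OpenPartialHomeomorph X (Fin k → ℂ)), x ∈ φ.source ∧
      ContMDiffOn IX 𝓘(ℝ, Fin k → ℂ) ∞ φ φ.source ∧
      ContMDiffOn 𝓘(ℝ, Fin k → ℂ) IX ∞ φ.symm φ.target ∧
      ∀ y ∈ φ.source, ∀ v : TangentSpace IX y,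
        mvfderiv IX φ y (gluedEnd IX P A L y v) = Complex.I • mvfderiv IX φ y v := by
  obtain ⟨k, φ, hx, h1, h2, h3⟩ := hA.integrable (P x x).1
  obtain ⟨C, hC⟩ := hL.coord
  let κ : ((Fin k → ℂ) × (Fin 2 → ℂ)) ≃L[ℂ] (Fin (k + 2) → ℂ) :=
    ContinuousLinearEquiv.ofFinrankEq (by simp)
  let κ' : ((Fin k → ℂ) × (Fin 2 → ℂ)) ≃L[ℝ] (Fin (k + 2) → ℂ) :=
    { κ.toLinearEquiv.restrictScalars ℝ with
      continuous_toFun := κ.continuous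
      continuous_invFun := κ.symm.continuous }
  refine ⟨k + 2, (P x).trans ((φ.prod C.toHomeomorph.toOpenPartialHomeomorph).trans
    κ'.toHomeomorph.toOpenPartialHomeomorph), ?_, ?_, ?_, ?_⟩
  · simpa using ⟨hP.mem x, hx⟩
  · intro y hy
    have hy1 : y ∈ (P x).source := by simp at hy; exact hy.1
    have hy2 : (P x y).1 ∈ φ.source := by simp at hy; exact hy.2
    have a1 := (h1.contMDiffAt (φ.open_source.mem_nhds hy2)).comp y (hP.smoothAt_fst hy1)
    have a2 := (C.contDiff.contMDiff.contMDiffAt (n := ∞)).comp y (hP.smoothAt_snd hy1)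
    exact ((κ'.contDiff.contMDiff.contMDiffAt (n := ∞)).comp y
      (a1.prodMk_space a2)).contMDiffWithinAt
  · intro u hu
    have hu1 : (κ'.symm u).1 ∈ φ.target := by
      simp at hu; exact hu.1
    have hu2 : (φ.symm (κ'.symm u).1, C.symm (κ'.symm u).2) ∈ (P x).target := by
      simp at hu; exact hu.2
    have a0 := κ'.symm.contDiff.contMDiff.contMDiffAt (n := ∞) (x := u)
    have a1 := (h2.contMDiffAt (φ.open_target.mem_nhds hu1)).comp u
      ((ContinuousLinearMap.fst ℝ (Fin k → ℂ) (Fin 2 → ℂ)).contMDiff.contMDiffAt.comp u a0)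
    have a2 := (C.symm.contDiff.contMDiff.contMDiffAt (n := ∞)).comp u
      ((ContinuousLinearMap.snd ℝ (Fin k → ℂ) (Fin 2 → ℂ)).contMDiff.contMDiffAt.comp u a0)
    have a3 := (hP.smooth_symm x).contMDiffAt ((P x).open_target.mem_nhds hu2)
    exact (a3.comp u (a1.prodMk a2)).contMDiffWithinAt
  · intro y hy v
    have hy1 : y ∈ (P x).source := by simp at hy; exact hy.1
    have hy2 : (P x y).1 ∈ φ.source := by simp at hy; exact hy.2
    let F : E →L[ℝ] (Fin k → ℂ) := mvfderiv IM φ (P x y).1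
    have b1 : HasMFDerivAt IM 𝓘(ℝ, Fin k → ℂ) φ (P x y).1 F :=
      ((h1.contMDiffAt (φ.open_source.mem_nhds hy2)).mdifferentiableAt (by simp)).hasMFDerivAt
    let D1 : EX →L[ℝ] E := baseDeriv IX IM (P x) y
    let D2 : EX →L[ℝ] Quat := quatDeriv IX (P x) y
    have b2 : HasMFDerivAt IX IM (fun z => (P x z).1) y D1 :=
      ((hP.smoothAt_fst hy1).mdifferentiableAt (by simp)).hasMFDerivAt
    have b3 : HasMFDerivAt IX 𝓘(ℝ, Quat) (fun z => (P x z).2) y D2 :=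
      ((hP.smoothAt_snd hy1).mdifferentiableAt (by simp)).hasMFDerivAt
    let F1 : EX →L[ℝ] (Fin k → ℂ) := F.comp D1
    let F2 : EX →L[ℝ] (Fin 2 → ℂ) := (C : Quat →L[ℝ] (Fin 2 → ℂ)).comp D2
    let F3 : EX →L[ℝ] (Fin (k + 2) → ℂ) :=
      (κ' : ((Fin k → ℂ) × (Fin 2 → ℂ)) →L[ℝ] (Fin (k + 2) → ℂ)).comp (F1.prod F2)
    have b4 : HasMFDerivAt IX 𝓘(ℝ, Fin k → ℂ) (fun z => φ (P x z).1) y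
        F1 := b1.comp y b2
    have b5 : HasMFDerivAt IX 𝓘(ℝ, Fin 2 → ℂ) (fun z => C (P x z).2) y
        F2 :=
      (C.hasFDerivAt (x := (P x y).2)).hasMFDerivAt.comp y b3
    have b6 : HasMFDerivAt IX 𝓘(ℝ, Fin (k + 2) → ℂ) (fun z => κ' (φ (P x z).1, C (P x z).2)) y
        F3 :=
      (κ'.hasFDerivAt (x := (φ (P x y).1, C (P x y).2))).hasMFDerivAt.comp y (b4.prodMk b5)
    -- the differential of the chart is `κ ∘ (dφ × C)`, each factor of which is complex linear for
    -- the structures at hand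
    have b7 : ∀ u : EX, (mvfderiv IX (fun z => κ' (φ (P x z).1, C (P x z).2)) y :
        EX →L[ℝ] (Fin (k + 2) → ℂ)) u =
        κ (F (baseDeriv IX IM (P x) y u), C (quatDeriv IX (P x) y u)) := fun u =>
      congrArg (fun T : EX →L[ℝ] (Fin (k + 2) → ℂ) => T u) b6.mfderiv
    have b8 : F (baseDeriv IX IM (P x) y ((gluedEnd IX P A L y : EX →L[ℝ] EX) v)) =
        Complex.I • F (baseDeriv IX IM (P x) y v) :=
      (congrArg F (hP.baseDeriv_gluedEnd hy1 hinv L v)).trans (h3 _ hy2 _)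
    have b9 : C (quatDeriv IX (P x) y ((gluedEnd IX P A L y : EX →L[ℝ] EX) v)) =
        Complex.I • C (quatDeriv IX (P x) y v) :=
      (congrArg C (hP.quatDeriv_gluedEnd hy1 hinv L v)).trans (hC _)
    refine (b7 _).trans (Eq.trans ?_ (congrArg (Complex.I • ·) (b7 v)).symm)
    exact (congrArg κ (Prod.ext b8 b9)).trans (κ.map_smul Complex.I
      (F (baseDeriv IX IM (P x) y v), C (quatDeriv IX (P x) y v)))

variable [FiniteDimensional ℝ EX] [IsManifold IX ∞ X]

theorem gluedEnd_isComplexStructure {A : EndField IM N} (hA : IsComplexStructure A)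
    (hinv : s.IsInvariant A) {L : Quat →L[ℝ] Quat} (hL : IsQuatComplexStructure L) :
    IsComplexStructure (gluedEnd IX P A L) where
  smooth := hP.gluedEnd_isSmooth hA.smooth hinv L
  sq x v := by
    refine hP.gluedEnd_gluedEnd hinv hinv L L (v := v) (u := (-v : EX)) ?_ ?_
    · exact (hA.sq _ _).trans (map_neg (baseDeriv IX IM (P x) x) (v : EX)).symm
    · exact (hL.sq _).trans (map_neg (quatDeriv IX (P x) x) (v : EX)).symm
  integrable := hP.exists_holomorphic_chart hA hinv hL

/-- The hyperhermitian structure on `X` given, in the local models, by the product of the structure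
of `N` and of the conformally flat structure of the nonzero quaternions. -/
def glue : HyperhermitianStructure IX X where
  I := gluedEnd IX P s.I quatI
  J := gluedEnd IX P s.J quatJ
  K := gluedEnd IX P s.K quatK
  g := hP.metric
  complex_I := hP.gluedEnd_isComplexStructure s.complex_I (fun _ hf => hf.map_I)
    isQuatComplexStructure_quatI
  complex_J := hP.gluedEnd_isComplexStructure s.complex_J (fun _ hf => hf.map_J)
    isQuatComplexStructure_quatJ
  complex_K := hP.gluedEnd_isComplexStructure s.complex_K (fun _ hf => hf.map_K)
    isQuatComplexStructure_quatK
  I_mul_J x v := by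
    refine hP.gluedEnd_gluedEnd (fun _ hf => hf.map_I) (fun _ hf => hf.map_J) quatI quatJ
      (v := v) (u := (gluedEnd IX P s.K quatK x v : EX)) ?_ ?_
    · exact (s.I_mul_J _ _).trans
        (hP.baseDeriv_gluedEnd (hP.mem x) (fun _ hf => hf.map_K) quatK v).symm
    · exact (quatI_quatJ _).trans
        (hP.quatDeriv_gluedEnd (hP.mem x) (fun _ hf => hf.map_K) quatK v).symm
  J_mul_I x v := by
    refine hP.gluedEnd_gluedEnd (fun _ hf => hf.map_J) (fun _ hf => hf.map_I) quatJ quatI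
      (v := v) (u := (-gluedEnd IX P s.K quatK x v : EX)) ?_ ?_
    · exact (s.J_mul_I _ _).trans ((congrArg Neg.neg
        (hP.baseDeriv_gluedEnd (hP.mem x) (fun _ hf => hf.map_K) quatK v)).symm.trans
        (map_neg (baseDeriv IX IM (P x) x) _).symm)
    · exact (quatJ_quatI _).trans ((congrArg Neg.neg
        (hP.quatDeriv_gluedEnd (hP.mem x) (fun _ hf => hf.map_K) quatK v)).symm.trans
        (map_neg (quatDeriv IX (P x) x) _).symm)
  skew_I := hP.gluedEnd_isSkew s.skew_I (fun _ hf => hf.map_I) isQuatComplexStructure_quatI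
  skew_J := hP.gluedEnd_isSkew s.skew_J (fun _ hf => hf.map_J) isQuatComplexStructure_quatJ
  skew_K := hP.gluedEnd_isSkew s.skew_K (fun _ hf => hf.map_K) isQuatComplexStructure_quatK

theorem glue_isStrongHKT [IM.Boundaryless] [IX.Boundaryless] [FiniteDimensional ℝ E]
    (hs : s.IsHyperkahler) : hP.glue.IsStrongHKT := by
  have tI := fun x : X => hP.bismutTorsion_eq s.complex_I.smooth s.skew_I hs.closed_I
    (fun _ hf => hf.map_I) isQuatComplexStructure_quatI (hP.mem x)
  have tJ := fun x : X => hP.bismutTorsion_eq s.complex_J.smooth s.skew_J hs.closed_J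
    (fun _ hf => hf.map_J) isQuatComplexStructure_quatJ (hP.mem x)
  have tK := fun x : X => hP.bismutTorsion_eq s.complex_K.smooth s.skew_K hs.closed_K
    (fun _ hf => hf.map_K) isQuatComplexStructure_quatK (hP.mem x)
  have key : ∀ {L : Quat →L[ℝ] Quat} (hL : IsQuatComplexStructure L), (∀ w, w ≠ 0 →
      conformalTorsion hL w = conformalTorsion isQuatComplexStructure_quatI w) → ∀ x : X,
      FormField.pullback (IM' := 𝓘(ℝ, Quat)) (M' := Quat) IX (fun z => (P x z).2)
          (conformalTorsion hL) x =
        FormField.pullback (IM' := 𝓘(ℝ, Quat)) (M' := Quat) IX (fun z => (P x z).2)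
          (conformalTorsion isQuatComplexStructure_quatI) x := fun hL h x =>
    congrArg (fun b : Quat [⋀^Fin 3]→L[ℝ] ℝ => b.compContinuousLinearMap (quatDeriv IX (P x) x))
      (h _ (hP.ne_zero x x (hP.mem x)))
  have eJ : bismutTorsion hP.glue.g hP.glue.J hP.glue.skew_J =
      bismutTorsion hP.glue.g hP.glue.I hP.glue.skew_I := funext fun x =>
    (tJ x).trans ((key _ (fun w hw => conformalTorsion_quatJ hw) x).trans (tI x).symm)
  have eK : bismutTorsion hP.glue.g hP.glue.K hP.glue.skew_K =
      bismutTorsion hP.glue.g hP.glue.I hP.glue.skew_I := funext fun x =>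
    (tK x).trans ((key _ (fun w hw => conformalTorsion_quatK hw) x).trans (tI x).symm)
  have hI : (bismutTorsion hP.glue.g hP.glue.I hP.glue.skew_I).extDer = 0 :=
    hP.extDer_bismutTorsion_eq_zero s.complex_I.smooth s.skew_I hs.closed_I
      (fun _ hf => hf.map_I) isQuatComplexStructure_quatI fun _ _ => rfl
  refine ⟨fun u v w _ _ _ x => ?_, hI, eJ ▸ hI, eK ▸ hI⟩
  simp only [bismutConnection, eJ, eK, and_self]

end IsModelAtlas

end GluedStructure

/-! ### Powers of a hyperkähler isometry -/

section Isometries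

variable {E : Type*} [NormedAddCommGroup E] [NormedSpace ℝ E]
  {H : Type*} [TopologicalSpace H] {IM : ModelWithCorners ℝ E H}
  {N : Type*} [TopologicalSpace N] [ChartedSpace H N]

theorem EndField.apply_congr (A : EndField IM N) {p q : N} (h : p = q) {v v' : E} (hv : v = v') :
    (A p : E →L[ℝ] E) v = (A q : E →L[ℝ] E) v' := by
  subst h hv
  rfl

variable [IsManifold IM ∞ N] {s : HyperhermitianStructure IM N}

theorem SmoothMetric.inner_congr (g : SmoothMetric IM N) {p q : N} (h : p = q)
    {v w v' w' : E} (hv : v = v') (hw : w = w') :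
    (g.inner p : E →L[ℝ] E →L[ℝ] ℝ) v w = (g.inner q : E →L[ℝ] E →L[ℝ] ℝ) v' w' := by
  subst h hv hw
  rfl

namespace HyperhermitianStructure.Preserves

theorem id (s : HyperhermitianStructure IM N) : s.Preserves fun x => x where
  smooth := contMDiff_id
  metric x v w := by
    have h := mfderiv_id (I := IM) (x := x)
    exact s.g.inner_congr rfl (congrArg (fun T : E →L[ℝ] E => T v) h)
      (congrArg (fun T : E →L[ℝ] E => T w) h)
  map_I x v := by
    have h := fun u : E => congrArg (fun T : E →L[ℝ] E => T u) (mfderiv_id (I := IM) (x := x))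
    exact (h _).trans (s.I.apply_congr rfl (h v).symm)
  map_J x v := by
    have h := fun u : E => congrArg (fun T : E →L[ℝ] E => T u) (mfderiv_id (I := IM) (x := x))
    exact (h _).trans (s.J.apply_congr rfl (h v).symm)
  map_K x v := by
    have h := fun u : E => congrArg (fun T : E →L[ℝ] E => T u) (mfderiv_id (I := IM) (x := x))
    exact (h _).trans (s.K.apply_congr rfl (h v).symm)

theorem isInvariant_comp {f h : N → N} (hf : s.Preserves f) (hh : s.Preserves h)
    {A : EndField IM N} (hA : s.IsInvariant A) (x : N) (v : TangentSpace IM x) :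
    mfderiv IM IM (fun y => f (h y)) x (A x v) =
      A (f (h x)) (mfderiv IM IM (fun y => f (h y)) x v) := by
  have h1 := fun u : E => congrArg (fun T : E →L[ℝ] E => T u)
    (mfderiv_comp x (hf.smooth.mdifferentiable (by simp) _)
      (hh.smooth.mdifferentiable (by simp) x))
  refine (h1 _).trans (Eq.trans ?_ (A.apply_congr rfl (h1 v).symm))
  exact (congrArg (mfderiv IM IM f (h x)) (hA h hh x v)).trans (hA f hf (h x) _)

theorem comp {f h : N → N} (hf : s.Preserves f) (hh : s.Preserves h) :
    s.Preserves fun x => f (h x) where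
  smooth := hf.smooth.comp hh.smooth
  metric x v w := by
    have h1 := fun u : E => congrArg (fun T : E →L[ℝ] E => T u)
      (mfderiv_comp x (hf.smooth.mdifferentiable (by simp) _)
        (hh.smooth.mdifferentiable (by simp) x))
    exact (s.g.inner_congr rfl (h1 v) (h1 w)).trans
      ((hf.metric (h x) _ _).trans (hh.metric x v w))
  map_I := isInvariant_comp hf hh fun _ hf => hf.map_I
  map_J := isInvariant_comp hf hh fun _ hf => hf.map_J
  map_K := isInvariant_comp hf hh fun _ hf => hf.map_K

theorem mfderiv_rightInverse {f h : N → N} (hf : s.Preserves f) (hh : ContMDiff IM IM ∞ h)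
    (hfh : ∀ x, f (h x) = x) (x : N) (u : E) :
    (mfderiv IM IM f (h x) : E →L[ℝ] E) ((mfderiv IM IM h x : E →L[ℝ] E) u) = u := by
  have h1 := mfderiv_comp x (hf.smooth.mdifferentiable (by simp) (h x))
    (hh.mdifferentiable (by simp) x)
  have h2 : f ∘ h = _root_.id := funext hfh
  rw [h2] at h1
  exact congrArg (fun T : E →L[ℝ] E => T u) (h1.symm.trans mfderiv_id)

theorem isInvariant_rightInverse {f h : N → N} (hf : s.Preserves f) (hh : ContMDiff IM IM ∞ h)
    (hfh : ∀ x, f (h x) = x) {A : EndField IM N} (hA : s.IsInvariant A) (x : N)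
    (v : TangentSpace IM x) :
    mfderiv IM IM h x (A x v) = A (h x) (mfderiv IM IM h x v) := by
  refine hf.mfderiv_injective (h x) ?_
  refine (hf.mfderiv_rightInverse hh hfh x _).trans (Eq.trans ?_ (hA f hf (h x) _).symm)
  exact (A.apply_congr (hfh x) (hf.mfderiv_rightInverse hh hfh x v)).symm

theorem rightInverse {f h : N → N} (hf : s.Preserves f) (hh : ContMDiff IM IM ∞ h)
    (hfh : ∀ x, f (h x) = x) : s.Preserves h where
  smooth := hh
  metric x v w := (hf.metric (h x) _ _).symm.trans (s.g.inner_congr (hfh x)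
    (hf.mfderiv_rightInverse hh hfh x v) (hf.mfderiv_rightInverse hh hfh x w))
  map_I := hf.isInvariant_rightInverse hh hfh fun _ hf => hf.map_I
  map_J := hf.isInvariant_rightInverse hh hfh fun _ hf => hf.map_J
  map_K := hf.isInvariant_rightInverse hh hfh fun _ hf => hf.map_K

end HyperhermitianStructure.Preserves

theorem HyperhermitianStructure.IsHyperIsometry.preserves_pow {ψ : N ≃ₘ^∞⟮IM, IM⟯ N}
    (hψ : s.IsHyperIsometry ψ) (k : ℕ) :
    s.Preserves (((ψ.toEquiv : Equiv.Perm N) ^ k : Equiv.Perm N) : N → N) := by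
  induction k with
  | zero => exact .id s
  | succ k ih =>
    rw [pow_succ]
    exact ih.comp ⟨ψ.contMDiff, hψ.metric, hψ.map_I, hψ.map_J, hψ.map_K⟩

theorem HyperhermitianStructure.IsHyperIsometry.preserves_zpow {ψ : N ≃ₘ^∞⟮IM, IM⟯ N}
    (hψ : s.IsHyperIsometry ψ) (n : ℤ) :
    s.Preserves (((ψ.toEquiv : Equiv.Perm N) ^ n : Equiv.Perm N) : N → N) := by
  obtain ⟨k, rfl | rfl⟩ := n.eq_nat_or_neg
  · rw [zpow_natCast]
    exact hψ.preserves_pow k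
  · refine (hψ.preserves_pow k).rightInverse (MappingTorus.contMDiff_zpow ψ _) fun x => ?_
    rw [zpow_neg, zpow_natCast]
    exact Equiv.apply_symm_apply _ x

end Isometries

/-! ### Local lifts from the mapping torus -/

namespace MappingTorus

variable {E : Type*} [NormedAddCommGroup E] [NormedSpace ℝ E]
  {H : Type*} [TopologicalSpace H] {IM : ModelWithCorners ℝ E H}
  {M : Type*} [TopologicalSpace M] [ChartedSpace H M] (f : M ≃ₘ^∞⟮IM, IM⟯ M)

/-- The chosen preimage of a point of the mapping torus. -/
def preimage (y : MappingTorus f) : M × ℝ :=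
  (mk_surjective f).hasRightInverse.choose y

theorem mk_preimage (y : MappingTorus f) : mk f (preimage f y) = y :=
  (mk_surjective f).hasRightInverse.choose_spec y

/-- The local lift to `M × ℝ` defined near a point of the mapping torus. -/
def lift (y : MappingTorus f) : OpenPartialHomeomorph (MappingTorus f) (M × ℝ) :=
  (isLocalHomeomorph_mk f).localInverseAt (preimage f y)

theorem mem_lift_source (y : MappingTorus f) : y ∈ (lift f y).source := by
  have h := (isLocalHomeomorph_mk f).apply_self_mem_localInverseAt_source (x := preimage f y)
  rwa [mk_preimage] at h

theorem lift_symm (y : MappingTorus f) : ((lift f y).symm : M × ℝ → MappingTorus f) = mk f :=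
  (isLocalHomeomorph_mk f).localInverseAt_symm _

theorem mk_lift {y z : MappingTorus f} (hz : z ∈ (lift f y).source) : mk f (lift f y z) = z :=
  (isLocalHomeomorph_mk f).apply_localInverseAt_of_mem hz

theorem chartAt_eq (y : MappingTorus f) : chartAt (ModelProd H ℝ) y =
    (lift f y).trans (chartAt (ModelProd H ℝ) (preimage f y)) := rfl

/-- Two local lifts differ by a deck transformation. -/
theorem exists_lift_eq_deck {y y' z : MappingTorus f} (hz : z ∈ (lift f y).source)
    (hz' : z ∈ (lift f y').source) :
    ∃ n : ℤ, ∀ᶠ u in 𝓝 z, lift f y' u = deck f n (lift f y u) := by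
  obtain ⟨n, hn⟩ := (mk_eq_iff f).1 ((mk_lift f hz').trans (mk_lift f hz).symm)
  refine ⟨n, ?_⟩
  have h1 : ∀ᶠ u in 𝓝 z, deck f n (lift f y u) ∈ (lift f y').target := by
    have hc : ContinuousAt (fun u => deck f n (lift f y u)) z :=
      (contMDiff_deck f n).continuous.continuousAt.comp ((lift f y).continuousAt hz)
    refine hc.eventually_mem ((lift f y').open_target.mem_nhds ?_)
    rw [hn]
    exact (lift f y').map_source hz'
  filter_upwards [h1, (lift f y).open_source.mem_nhds hz, (lift f y').open_source.mem_nhds hz']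
    with u hu1 hu2 hu3
  refine (isLocalHomeomorph_mk f).injOn_localInverseAt_target ((lift f y').map_source hu3) hu1 ?_
  exact (mk_lift f hu3).trans (((mk_eq_iff f).2 ⟨n, rfl⟩).trans (mk_lift f hu2)).symm

variable [IsManifold IM ∞ M]

theorem contMDiffAt_lift {y z : MappingTorus f} (hz : z ∈ (lift f y).source) :
    ContMDiffAt (IM.prod 𝓘(ℝ, ℝ)) (IM.prod 𝓘(ℝ, ℝ)) ∞ (lift f y) z := by
  set c := chartAt (ModelProd H ℝ) (preimage f z)
  have hz1 : z ∈ (chartAt (ModelProd H ℝ) z).source := mem_chart_source _ z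
  have hz0 := hz1
  rw [chartAt_eq, OpenPartialHomeomorph.trans_source] at hz1
  obtain ⟨n, hn⟩ := exists_lift_eq_deck f (mem_lift_source f z) hz
  have a1 : ContMDiffAt (IM.prod 𝓘(ℝ, ℝ)) (IM.prod 𝓘(ℝ, ℝ)) ∞
      (chartAt (ModelProd H ℝ) z) z := contMDiffOn_chart.contMDiffAt
        ((chartAt (ModelProd H ℝ) z).open_source.mem_nhds hz0)
  have a2 : ContMDiffAt (IM.prod 𝓘(ℝ, ℝ)) (IM.prod 𝓘(ℝ, ℝ)) ∞ c.symm
      (chartAt (ModelProd H ℝ) z z) := contMDiffOn_chart_symm.contMDiffAt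
        (c.open_target.mem_nhds (c.map_source hz1.2))
  refine ((contMDiff_deck f n).contMDiffAt.comp z (a2.comp z a1)).congr_of_eventuallyEq ?_
  filter_upwards [hn, (chartAt (ModelProd H ℝ) z).open_source.mem_nhds hz0] with u hu hu1
  rw [chartAt_eq, OpenPartialHomeomorph.trans_source] at hu1
  refine hu.trans (congrArg (deck f n) ?_)
  exact (c.left_inv hu1.2).symm

theorem contMDiff_mk : ContMDiff (IM.prod 𝓘(ℝ, ℝ)) (IM.prod 𝓘(ℝ, ℝ)) ∞ (mk f) := by
  intro p
  set y := mk f p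
  have hy := mem_chart_source (ModelProd H ℝ) y
  have a1 := contMDiffAt_localInverse_comp_mk f (preimage f y) p (mem_lift_source f y)
  have hy1 := hy
  rw [chartAt_eq, OpenPartialHomeomorph.trans_source] at hy1
  have a2 : ContMDiffAt (IM.prod 𝓘(ℝ, ℝ)) (IM.prod 𝓘(ℝ, ℝ)) ∞
      (chartAt (ModelProd H ℝ) (preimage f y)) (lift f y y) := contMDiffOn_chart.contMDiffAt
        ((chartAt (ModelProd H ℝ) (preimage f y)).open_source.mem_nhds hy1.2)
  have a3 : ContMDiffAt (IM.prod 𝓘(ℝ, ℝ)) (IM.prod 𝓘(ℝ, ℝ)) ∞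
      (chartAt (ModelProd H ℝ) y).symm (chartAt (ModelProd H ℝ) y y) :=
    contMDiffOn_chart_symm.contMDiffAt
      ((chartAt (ModelProd H ℝ) y).open_target.mem_nhds (mem_chart_target _ y))
  refine (ContMDiffAt.comp p a3 (ContMDiffAt.comp p a2 a1)).congr_of_eventuallyEq ?_
  filter_upwards [(continuous_mk f).continuousAt.eventually_mem
    ((chartAt (ModelProd H ℝ) y).open_source.mem_nhds hy)] with u hu
  exact ((chartAt (ModelProd H ℝ) y).left_inv hu).symm

end MappingTorus

/-! ### Polar coordinates on the quaternions -/

section Polar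

/-- The unit sphere of the quaternions. -/
abbrev UnitQuat : Type := Metric.sphere (0 : Quat) 1

/-- The direction `w / ‖w‖` of a nonzero quaternion, with an arbitrary value at `0`. -/
def direction (w : Quat) : UnitQuat :=
  if h : w = 0 then ⟨EuclideanSpace.single 0 1, by simp⟩
  else ⟨‖w‖⁻¹ • w, by simp [norm_smul, h]⟩

theorem coe_direction {w : Quat} (h : w ≠ 0) : (direction w : Quat) = ‖w‖⁻¹ • w := by
  rw [direction, dif_neg h]

theorem direction_smul {c : ℝ} (hc : 0 < c) (q : UnitQuat) : direction (c • (q : Quat)) = q := by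
  have hq : ‖(q : Quat)‖ = 1 := norm_eq_of_mem_sphere q
  have h : c • (q : Quat) ≠ 0 := smul_ne_zero hc.ne' (ne_zero_of_mem_unit_sphere q)
  refine Subtype.ext ?_
  rw [coe_direction h, norm_smul, hq, mul_one, Real.norm_of_nonneg hc.le, smul_smul,
    inv_mul_cancel₀ hc.ne', one_smul]

theorem contMDiffAt_direction {w : Quat} (h : w ≠ 0) :
    ContMDiffAt 𝓘(ℝ, Quat) (𝓡 3) ∞ direction w := by
  -- smooth maps into the sphere are characterized only globally, hence the restriction to `U`
  let U : TopologicalSpace.Opens Quat := ⟨{0}ᶜ, isOpen_compl_singleton⟩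
  have h1 : ContMDiff 𝓘(ℝ, Quat) 𝓘(ℝ, Quat) ∞ fun x : U => ‖(x : Quat)‖⁻¹ • (x : Quat) := by
    intro x
    have hx : (x : Quat) ≠ 0 := x.2
    have h2 : ContDiffAt ℝ ∞ (fun y : Quat => ‖y‖⁻¹ • y) x :=
      ((contDiffAt_norm ℝ hx).inv (norm_ne_zero_iff.2 hx)).smul contDiffAt_id
    exact contMDiffAt_subtype_iff.2 h2.contMDiffAt
  have : Fact (Module.finrank ℝ Quat = 3 + 1) := ⟨finrank_euclideanSpace_fin⟩
  have h3 := h1.codRestrict_sphere (n := 3) fun x => by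
    have hx : (x : Quat) ≠ 0 := x.2
    simp [norm_smul, hx]
  refine (contMDiffAt_subtype_iff (U := U) (x := ⟨w, h⟩)).1 ((h3 ⟨w, h⟩).congr_of_eventuallyEq ?_)
  exact Filter.Eventually.of_forall fun x => Subtype.ext (coe_direction x.2)

/-- Polar coordinates: `(t, q) ↦ eᵗ q` identifies `ℝ × S³` with the nonzero quaternions. -/
def polar : OpenPartialHomeomorph (ℝ × UnitQuat) Quat where
  toFun p := Real.exp p.1 • (p.2 : Quat)
  invFun w := (Real.log ‖w‖, direction w)
  source := Set.univ
  target := {0}ᶜ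
  map_source' p _ := smul_ne_zero (Real.exp_ne_zero _) (ne_zero_of_mem_unit_sphere p.2)
  map_target' _ _ := trivial
  left_inv' p _ := by
    refine Prod.ext ?_ (direction_smul (Real.exp_pos _) _)
    simp [norm_smul]
  right_inv' w hw := by
    have hw' : w ≠ 0 := hw
    simp only [coe_direction hw', Real.exp_log (norm_pos_iff.2 hw'), smul_smul]
    rw [mul_inv_cancel₀ (norm_ne_zero_iff.2 hw'), one_smul]
  open_source := isOpen_univ
  open_target := isOpen_compl_singleton
  continuousOn_toFun := by fun_prop
  continuousOn_invFun := fun w hw => by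
    have hw' : w ≠ 0 := hw
    exact ((continuous_norm.continuousAt.log (norm_ne_zero_iff.2 hw')).prodMk
      (contMDiffAt_direction hw').continuousAt).continuousWithinAt

theorem contMDiff_polar : ContMDiff (𝓘(ℝ, ℝ).prod (𝓡 3)) 𝓘(ℝ, Quat) ∞ polar :=
  have : Fact (Module.finrank ℝ Quat = 3 + 1) := ⟨finrank_euclideanSpace_fin⟩
  (Real.contDiff_exp.contMDiff.comp contMDiff_fst).smul
    ((contMDiff_coe_sphere (E := Quat) (n := 3)).comp contMDiff_snd)

theorem contMDiffAt_polar_symm {w : Quat} (h : w ≠ 0) :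
    ContMDiffAt 𝓘(ℝ, Quat) (𝓘(ℝ, ℝ).prod (𝓡 3)) ∞ polar.symm w :=
  (((contDiffAt_norm ℝ h).log (norm_ne_zero_iff.2 h)).contMDiffAt).prodMk (contMDiffAt_direction h)

end Polar

/-! ### The local models of the product of the mapping torus with the three-sphere -/

section Product

variable {E : Type*} [NormedAddCommGroup E] [NormedSpace ℝ E]
  {H : Type*} [TopologicalSpace H] {IM : ModelWithCorners ℝ E H}
  {N : Type*} [TopologicalSpace N] [ChartedSpace H N]
  (ψ : N ≃ₘ^∞⟮IM, IM⟯ N)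

/-- The local model `(m, q) ↦ (p, eᵗ q)`, where `(p, t)` is the local lift of `m`. -/
def torusModel (x : MappingTorus ψ × UnitQuat) :
    OpenPartialHomeomorph (MappingTorus ψ × UnitQuat) (N × Quat) :=
  ((MappingTorus.lift ψ x.1).prod (OpenPartialHomeomorph.refl UnitQuat)).trans
    ((Homeomorph.prodAssoc N ℝ UnitQuat).toOpenPartialHomeomorph.trans
      ((OpenPartialHomeomorph.refl N).prod polar))

theorem torusModel_apply (x y : MappingTorus ψ × UnitQuat) : torusModel ψ x y =
    ((MappingTorus.lift ψ x.1 y.1).1, polar ((MappingTorus.lift ψ x.1 y.1).2, y.2)) := rfl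

theorem mem_torusModel_source {x y : MappingTorus ψ × UnitQuat} :
    y ∈ (torusModel ψ x).source ↔ y.1 ∈ (MappingTorus.lift ψ x.1).source := by
  simp [torusModel, polar]

theorem torusModel_symm_apply (x : MappingTorus ψ × UnitQuat) (p : N × Quat) :
    (torusModel ψ x).symm p = (MappingTorus.mk ψ (p.1, (polar.symm p.2).1), (polar.symm p.2).2) :=
  Prod.ext (congrFun (MappingTorus.lift_symm ψ x.1) _) rfl

theorem ne_zero_of_mem_torusModel_target {x : MappingTorus ψ × UnitQuat} {p : N × Quat}
    (hp : p ∈ (torusModel ψ x).target) : p.2 ≠ 0 := by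
  rw [← (torusModel ψ x).right_inv hp]
  exact polar.map_source trivial

theorem isModelAtlas_torusModel [IsManifold IM ∞ N] {s : HyperhermitianStructure IM N}
    (hψ : s.IsHyperIsometry ψ) :
    IsModelAtlas ((IM.prod 𝓘(ℝ, ℝ)).prod (𝓡 3)) s (torusModel ψ) where
  mem x := (mem_torusModel_source ψ).2 (MappingTorus.mem_lift_source ψ x.1)
  ne_zero x y _ := polar.map_source trivial
  smooth x y hy := by
    have h1 := (MappingTorus.contMDiffAt_lift ψ ((mem_torusModel_source ψ).1 hy)).comp y
      (contMDiffAt_fst (J := 𝓡 3))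
    have h2 := contMDiff_polar.contMDiffAt.comp y
      ((contMDiffAt_snd.comp y h1).prodMk (contMDiffAt_snd (I := IM.prod 𝓘(ℝ, ℝ))))
    exact ((contMDiffAt_fst.comp y h1).prodMk h2).contMDiffWithinAt
  smooth_symm x p hp := by
    have h1 := (contMDiffAt_polar_symm (ne_zero_of_mem_torusModel_target ψ hp)).comp p
      (contMDiffAt_snd (I := IM))
    have h2 := (MappingTorus.contMDiff_mk ψ).contMDiffAt.comp p
      (contMDiffAt_fst.prodMk (contMDiffAt_fst.comp p h1))
    exact ((h2.prodMk (contMDiffAt_snd.comp p h1)).congr_of_eventuallyEq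
      (Filter.Eventually.of_forall (torusModel_symm_apply ψ x))).contMDiffWithinAt
  compat x y hy := by
    obtain ⟨n, hn⟩ := MappingTorus.exists_lift_eq_deck ψ ((mem_torusModel_source ψ).1 hy)
      (MappingTorus.mem_lift_source ψ y.1)
    refine ⟨_, Real.exp n, hψ.preserves_zpow n, Real.exp_ne_zero _, ?_⟩
    filter_upwards [continuous_fst.continuousAt.eventually hn] with z hz
    rw [torusModel_apply, hz]
    refine Prod.ext rfl ?_
    change Real.exp ((MappingTorus.lift ψ x.1 z.1).2 + n) • (z.2 : Quat) =
      Real.exp n • Real.exp (MappingTorus.lift ψ x.1 z.1).2 • (z.2 : Quat)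
    rw [smul_smul, ← Real.exp_add, add_comm]

end Product

theorem theorem4p1
    {E : Type*} [NormedAddCommGroup E] [NormedSpace ℝ E] [FiniteDimensional ℝ E]
    {H : Type*} [TopologicalSpace H] (IM : ModelWithCorners ℝ E H) [IM.Boundaryless]
    (N : Type*) [TopologicalSpace N] [ChartedSpace H N] [IsManifold IM ∞ N]
    [T2Space N] [CompactSpace N]
    (s : HyperhermitianStructure IM N) (hs : s.IsHyperkahler)
    (ψ : N ≃ₘ^∞⟮IM, IM⟯ N) (hψ : s.IsHyperIsometry ψ) :
    ∃ S : HyperhermitianStructure ((IM.prod 𝓘(ℝ, ℝ)).prod (𝓡 3))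
        (MappingTorus ψ × Metric.sphere (0 : EuclideanSpace ℝ (Fin 4)) 1),
      S.IsStrongHKT :=
  ⟨(isModelAtlas_torusModel ψ hψ).glue, (isModelAtlas_torusModel ψ hψ).glue_isStrongHKT hs⟩

end
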